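/- Let $\mathcal B$ be the set of all functions $\varphi\colon\{0,1\}^*\to\{0,1\}^*$ (Baire space), and for $\varphi\in\mathcal B$ let $|\varphi|(n):=\max\{|\varphi(a)| : |a|\le n\}$. The second-order polynomials are the smallest class of functions $P\colon\mathbb N^{\mathbb N}\times\mathbb N\to\mathbb N$ that contains $(l,n)\mapsto p(n)$ for every polynomial $p$ with coefficients in $\mathbb N$ and is closed under point-wise sums, point-wise products and $P\mapsto\big((l,n)\mapsto l(P(l,n))\big)$. An oracle Turing machine $M^?$ is a deterministic Turing machine with finitely many states and finitely many one-sided infinite tapes over $\{0,1,\text{blank}\}$, among them an input tape, an output tape, a query tape and an answer tape. When it is in its query state with the string $b$ on the query tape and oracle $\varphi\in\mathcal B$, then in one time step the content of the answer tape is replaced with $\varphi(b)$, and no head moves. If the computation with oracle $\varphi$ on input $a$ terminates, the string then on the output tape is $M^\varphi(a)$ and the number of steps is $\mathrm{time}_{M^\varphi}(a)$. For $A\subseteq\mathcal B$, the machine computes $F\colon A\to\mathcal B$ if $M^\varphi=F(\varphi)$ for all $\varphi\in A$. For $A\subseteq\mathcal B$, a functional $F\colon A\to\mathcal B$ is $A$-restricted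 polynomial-time computable, $F\in\mathrm P(A)$, if there are an oracle Turing machine $M^?$ computing $F$ and a second-order polynomial $P$ such that $\mathrm{time}_{M^\varphi}(a)\le P(|\varphi|,|a|)$ for all $\varphi\in A$ and all $a\in\{0,1\}^*$. A total functional $\mathcal B\to\mathcal B$ is polynomial-time computable if this holds with $A=\mathcal B$. Let $\mathrm P|_A$ be the class of all $F\colon A\to\mathcal B$ that have an extension $G\colon\mathcal B\to\mathcal B$ that is polynomial-time computable. A retraction of $\mathcal B$ onto $A$ is a map $R\colon\mathcal B\to A$ with $R(\varphi)=\varphi$ for all $\varphi\in A$; it is called polynomial-time computable if it is so as a functional $\mathcal B\to\mathcal B$. Let $\mathrm{reg}$ be the set of length-monotone functions, i.e. of all $\varphi\in\mathcal B$ such that $|a|\le|b|$ implies $|\varphi(a)|\le|\varphi(b)|$. A functional $F\colon\mathrm{reg}\to\mathcal B$ is polynomial-time computable in the sense of Kawamura and Cook if $F\in\mathrm P(\mathrm{reg})$. **Theorem.** 1. Let $A\subseteq\mathcal B$. If there is a polynomial-time computable retraction of $\mathcal B$ onto $A$, then every $A$-restricted polynomial-time computable functional has a total polynomial-time computable extension;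 that is, $\mathrm P|_A=\mathrm P(A)$. 2. There is a polynomial-time computable retraction of $\mathcal B$ onto $\mathrm{reg}$. 3. A functional $F\colon\mathrm{reg}\to\mathcal B$ is polynomial-time computable in the sense of Kawamura and Cook if and only if it has a total polynomial-time computable extension; that is, $\mathrm P(\mathrm{reg})=\mathrm P|_{\mathrm{reg}}$. -/

import Mathlib

namespace SecondOrder

/-- Finite binary strings. -/
abbrev Str : Type := List Bool

/-- Baire space, identified with the set of all string functions. -/
abbrev Baire : Type := Str → Str

/-- The size function of a string function: `size φ n` is the maximum of `|φ a|` over all strings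
`a` with `|a| ≤ n` (the set is finite and nonempty, see `isGreatest_size`). -/
noncomputable def size (φ : Baire) (n : ℕ) : ℕ :=
  sSup ((fun a : Str => (φ a).length) '' {a : Str | a.length ≤ n})

theorem isGreatest_size (φ : Baire) (n : ℕ) :
    IsGreatest ((fun a : Str => (φ a).length) '' {a : Str | a.length ≤ n}) (size φ n) := by
  have hfin : ((fun a : Str => (φ a).length) '' {a : Str | a.length ≤ n}).Finite :=
    (List.finite_length_le Bool n).image _
  have hne : ((fun a : Str => (φ a).length) '' {a : Str | a.length ≤ n}).Nonempty :=
    ⟨_, [], by simp, rfl⟩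
  exact ⟨Nat.sSup_mem hne hfin.bddAbove, fun x hx => le_csSup hfin.bddAbove hx⟩

/-- Second-order polynomials: the smallest class of functions `(ℕ → ℕ) × ℕ → ℕ` that contains the
maps `(l, n) ↦ p n` for polynomials `p` with natural coefficients and is closed under point-wise
sums, point-wise products and `P ↦ ((l, n) ↦ l (P (l, n)))`. -/
inductive IsSecondOrderPoly : ((ℕ → ℕ) → ℕ → ℕ) → Prop
  | poly (p : Polynomial ℕ) : IsSecondOrderPoly (fun _ n => p.eval n)
  | add {P Q : (ℕ → ℕ) → ℕ → ℕ} : IsSecondOrderPoly P → IsSecondOrderPoly Q →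
      IsSecondOrderPoly (fun l n => P l n + Q l n)
  | mul {P Q : (ℕ → ℕ) → ℕ → ℕ} : IsSecondOrderPoly P → IsSecondOrderPoly Q →
      IsSecondOrderPoly (fun l n => P l n * Q l n)
  | app {P : (ℕ → ℕ) → ℕ → ℕ} : IsSecondOrderPoly P →
      IsSecondOrderPoly (fun l n => l (P l n))

/-! ### Oracle Turing machines -/

/-- Tape symbols: `some false`, `some true` are the letters of the alphabet, `none` is blank. -/
abbrev Symbol : Type := Option Bool

/-- The contents of a one-sided infinite tape. -/
abbrev Tape : Type := ℕ → Symbol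

/-- The tape carrying the string `s` in its first cells and blanks elsewhere. -/
def Tape.ofStr (s : Str) : Tape := fun i => s[i]?

/-- The string on a tape: the letters in front of the first blank cell. (A tape that occurs in a
computation has only finitely many non-blank cells, so that the second case never occurs.) -/
noncomputable def Tape.content (t : Tape) : Str :=
  open Classical in
  if h : ∃ n, t n = none then (List.range (Nat.find h)).filterMap t else []

theorem Tape.content_ofStr (s : Str) : (Tape.ofStr s).content = s := by
  classical
  have h : ∃ n, Tape.ofStr s n = none := ⟨s.length, by simp [Tape.ofStr]⟩
  have hn : Nat.find h = s.length := by
    rw [Nat.find_eq_iff]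
    refine ⟨by simp [Tape.ofStr], fun n hn => ?_⟩
    simp [Tape.ofStr, hn]
  have key : ∀ s : Str, (List.range s.length).filterMap (Tape.ofStr s) = s := by
    intro s
    induction s with
    | nil => rfl
    | cons b s ih =>
      rw [List.length_cons, List.range_succ_eq_map, List.filterMap_cons, List.filterMap_map]
      have : Tape.ofStr (b :: s) ∘ Nat.succ = Tape.ofStr s := by
        funext i; simp [Tape.ofStr]
      rw [this, ih]
      simp [Tape.ofStr]
  unfold Tape.content
  rw [dif_pos h]
  have := key s
  rw [← hn] at this
  convert this using 2

/-- The tapes of a machine: an input tape, an output tape, a tape on which oracle queries are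
written, a tape on which oracle answers appear, and a family of memory tapes. -/
inductive TapeName (W : Type) : Type
  | input : TapeName W
  | output : TapeName W
  | query : TapeName W
  | answer : TapeName W
  | work (w : W) : TapeName W

/-- Head movements. -/
inductive Move : Type
  | left | stay | right

/-- The head position after a move; a head on the leftmost cell stays there when moved left. -/
def Move.apply : Move → ℕ → ℕ
  | .left, h => h - 1
  | .stay, h => h
  | .right, h => h + 1

/-- A deterministic multi-tape oracle Turing machine. According to the state and the scanned
symbols, `next` gives the new state and, for each tape, the symbol to write and the head move. It
is not used in the states `halt` and `query`. -/
structure OracleTM where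
  State : Type
  [decState : DecidableEq State]
  [finState : Finite State]
  Work : Type
  [finWork : Finite Work]
  start : State
  halt : State
  query : State
  resume : State
  next : State → (TapeName Work → Symbol) → State × (TapeName Work → Symbol × Move)

attribute [instance] OracleTM.decState OracleTM.finState OracleTM.finWork

namespace OracleTM

/-- A configuration: the state, the head positions and the tapes. -/
structure Cfg (M : OracleTM) where
  state : M.State
  head : TapeName M.Work → ℕ
  tape : TapeName M.Work → Tape

/-- The initial configuration: the input string is on the input tape, all other tapes are blank
and all heads are on the leftmost cell. -/
def init (M : OracleTM) (a : Str) : M.Cfg where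
  state := M.start
  head := fun _ => 0
  tape := fun k => match k with
    | .input => Tape.ofStr a
    | _ => fun _ => none

/-- Consulting the oracle: the content of the answer tape is replaced with the value of the oracle
on the string on the query tape. No head moves, and the machine continues in state `resume`. -/
noncomputable def ask (M : OracleTM) (φ : Baire) (c : M.Cfg) : M.Cfg where
  state := M.resume
  head := c.head
  tape := fun k => match k with
    | .answer => Tape.ofStr (φ (c.tape .query).content)
    | k => c.tape k

/-- An ordinary step: write and move on each tape. -/
def move (M : OracleTM) (c : M.Cfg) : M.Cfg :=
  let r := M.next c.state (fun k => c.tape k (c.head k))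
  { state := r.1
    head := fun k => (r.2 k).2.apply (c.head k)
    tape := fun k => Function.update (c.tape k) (c.head k) (r.2 k).1 }

/-- One time step with oracle `φ`. In particular an oracle call takes one step. A halted machine
does not change any more. -/
noncomputable def step (M : OracleTM) (φ : Baire) (c : M.Cfg) : M.Cfg :=
  if c.state = M.halt then c
  else if c.state = M.query then M.ask φ c
  else M.move c

/-- The configuration after `n` steps with oracle `φ` on input `a`. -/
noncomputable def run (M : OracleTM) (φ : Baire) (a : Str) (n : ℕ) : M.Cfg :=
  (M.step φ)^[n] (M.init a)

/-- With oracle `φ` and on input `a` the machine terminates within `n` steps. -/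
def HaltsWithin (M : OracleTM) (φ : Baire) (a : Str) (n : ℕ) : Prop :=
  ∃ m ≤ n, (M.run φ a m).state = M.halt

/-- With oracle `φ` and on input `a` the machine terminates with return value `b`. -/
def Returns (M : OracleTM) (φ : Baire) (a b : Str) : Prop :=
  ∃ m, (M.run φ a m).state = M.halt ∧ ((M.run φ a m).tape .output).content = b

/-- The machine computes the partial functional `F` with domain `A`. -/
def Computes (M : OracleTM) {A : Set Baire} (F : A → Baire) : Prop :=
  ∀ (φ : A) (a : Str), M.Returns φ a (F φ a)

/-- The machine runs in `A`-restricted polynomial time. -/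
def RunsInPolyTimeOn (M : OracleTM) (A : Set Baire) : Prop :=
  ∃ P, IsSecondOrderPoly P ∧
    ∀ φ ∈ A, ∀ a : Str, M.HaltsWithin φ a (P (size φ) a.length)

end OracleTM

/-- A total functional is polynomial-time computable if it is computed by an oracle Turing machine
that has a second-order polynomial as running time. -/
def PolyTimeComputable (F : Baire → Baire) : Prop :=
  ∃ M : OracleTM, (∀ (φ : Baire) (a : Str), M.Returns φ a (F φ a)) ∧
    ∃ P, IsSecondOrderPoly P ∧
      ∀ (φ : Baire) (a : Str), M.HaltsWithin φ a (P (size φ) a.length)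

/-- The class `P(A)` of `A`-restricted polynomial-time computable functionals. -/
def restrictedPolyTime (A : Set Baire) : Set (A → Baire) :=
  {F | ∃ M : OracleTM, M.Computes F ∧ M.RunsInPolyTimeOn A}

/-- The class `P|_A` of functionals on `A` with a total polynomial-time computable extension. -/
def extendablePolyTime (A : Set Baire) : Set (A → Baire) :=
  {F | ∃ G : Baire → Baire, PolyTimeComputable G ∧ ∀ φ : A, G φ = F φ}

/-- Retractions of Baire space onto `A`. -/
def IsRetraction {A : Set Baire} (R : Baire → A) : Prop :=
  ∀ φ : A, R φ = φ

/-- The set of length-monotone string functions. -/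
def reg : Set Baire :=
  {φ | ∀ a b : Str, a.length ≤ b.length → (φ a).length ≤ (φ b).length}

/-- Polynomial-time computability in the sense of Kawamura and Cook: some machine computes `F` and
runs in second-order polynomial time on all length-monotone oracles. -/
def KawamuraCookPolyTime (F : reg → Baire) : Prop :=
  F ∈ restrictedPolyTime reg

end SecondOrder

namespace SecondOrder

/-! ### Size functions and second-order polynomials -/

/-! The core of part 1 is that a functional F in P(A) stays polynomial-time computable when
precomposed with a polynomial-time map R from Baire space into A (`polyTimeComputable_comp`). Let N
compute F on A in time Q and let R be computed in time P; answer each oracle call of N by a run of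
the machine for R. As Rφ always lies in A, the machine N only meets oracles for which its time bound
is valid, so the composite is total. An output is never longer than the time spent on it, so |Rφ| ≤
P(|φ|, ·). Hence N takes at most T = Q(P(|φ|, ·), n) steps, its queries have length at most T, and
each is answered in time P(|φ|, T) plus polynomial overhead. Second-order polynomials are monotone
and closed under both substitutions (`mono`, `comp_arg`, `comp_fun`), so the total is again such a
bound. If R is a retraction, F ∘ R extends F; conversely, a machine for an extension also computes
the restriction.

For part 2, |φ|(n) itself is a maximum over exponentially many strings. The maximum over the strings
of at most n zeros needs only n + 1 queries, is monotone in n, and equals |φ(a)| for |a| = n if φ is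
length-monotone. Truncating or padding φ(a) to this length gives the retraction `regularize`. Part 3
combines the first two.

The bulk of the proof verifies two explicit machines, `regMachine` and `comp`. In both, a unary
counter with an end marker serves as a ruler: it tells how far to work and when the heads are back
at the left end. -/

theorem length_le_size (φ : Baire) {a : Str} {n : ℕ} (h : a.length ≤ n) :
    (φ a).length ≤ size φ n :=
  (isGreatest_size φ n).2 ⟨a, h, rfl⟩

theorem exists_length_eq_size (φ : Baire) (n : ℕ) :
    ∃ a : Str, a.length ≤ n ∧ (φ a).length = size φ n :=
  (isGreatest_size φ n).1

theorem size_mono (φ : Baire) : Monotone (size φ) := by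
  intro m n h
  obtain ⟨a, ha, h'⟩ := exists_length_eq_size φ m
  exact h' ▸ length_le_size φ (ha.trans h)

theorem polynomial_eval_mono (p : Polynomial ℕ) : Monotone (fun n => p.eval n) := by
  intro m n h
  simp only [Polynomial.eval_eq_sum, Polynomial.sum]
  gcongr

namespace IsSecondOrderPoly

/-- In the case `app` the function and its argument grow together, which is why `l'` has to be
monotone. -/
theorem mono {P : (ℕ → ℕ) → ℕ → ℕ} (hP : IsSecondOrderPoly P) {l l' : ℕ → ℕ} (hl : l ≤ l')
    (hm : Monotone l') {n n' : ℕ} (hn : n ≤ n') : P l n ≤ P l' n' := by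
  induction hP with
  | poly p => exact polynomial_eval_mono p hn
  | add _ _ h₁ h₂ => exact add_le_add h₁ h₂
  | mul _ _ h₁ h₂ => exact Nat.mul_le_mul h₁ h₂
  | app _ h => exact (hl _).trans (hm h)

theorem const (c : ℕ) : IsSecondOrderPoly (fun _ _ => c) := by
  simpa using poly (Polynomial.C c)

theorem id : IsSecondOrderPoly (fun _ n => n) := by
  simpa using poly Polynomial.X

theorem pow {P : (ℕ → ℕ) → ℕ → ℕ} (hP : IsSecondOrderPoly P) (k : ℕ) :
    IsSecondOrderPoly (fun l n => P l n ^ k) := by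
  induction k with
  | zero => simpa using const 1
  | succ k ih => simpa only [pow_succ] using ih.mul hP

/-- A base polynomial has to be rebuilt from constants, powers and sums, since only sums and
products are available as closure properties. -/
theorem comp_arg {P Q : (ℕ → ℕ) → ℕ → ℕ} (hP : IsSecondOrderPoly P) (hQ : IsSecondOrderPoly Q) :
    IsSecondOrderPoly (fun l n => P l (Q l n)) := by
  induction hP with
  | poly p =>
    induction p using Polynomial.induction_on' with
    | add p q hp hq => simpa only [Polynomial.eval_add] using hp.add hq
    | monomial k c => simpa only [Polynomial.eval_monomial] using (const c).mul (hQ.pow k)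
  | add _ _ h₁ h₂ => exact h₁.add h₂
  | mul _ _ h₁ h₂ => exact h₁.mul h₂
  | app _ h => exact h.app

/-- Replacing the function in an application turns it into a substitution in the argument of `Q`, so
`comp_arg` carries the induction. -/
theorem comp_fun {P Q : (ℕ → ℕ) → ℕ → ℕ} (hP : IsSecondOrderPoly P) (hQ : IsSecondOrderPoly Q) :
    IsSecondOrderPoly (fun l n => P (Q l) n) := by
  induction hP with
  | poly p => exact poly p
  | add _ _ h₁ h₂ => exact h₁.add h₂
  | mul _ _ h₁ h₂ => exact h₁.mul h₂
  | app _ h => exact hQ.comp_arg h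

end IsSecondOrderPoly

/-! ### Tapes -/

/-- The blank tape. -/
def Tape.blank : Tape := fun _ => none

/-- The tape that keeps the letters in front of the first blank cell and is blank elsewhere. -/
noncomputable def Tape.pre (t : Tape) : Tape :=
  open Classical in fun j => if ∀ i ≤ j, t i ≠ none then t j else none

theorem Tape.content_length_le (t : Tape) {n : ℕ} (h : t n = none) : t.content.length ≤ n := by
  classical
  have hex : ∃ n, t n = none := ⟨n, h⟩
  unfold Tape.content
  rw [dif_pos hex]
  refine (List.length_filterMap_le _ _).trans ?_
  rw [List.length_range]
  convert Nat.find_min' hex h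

theorem Tape.exists_pre_eq_ofStr (t : Tape) (h : ∃ n, t n = none) :
    ∃ s : Str, t.pre = Tape.ofStr s := by
  classical
  refine ⟨(List.range (Nat.find h)).map fun i => (t i).getD false, ?_⟩
  funext j
  unfold Tape.pre Tape.ofStr
  rw [List.getElem?_map]
  split_ifs with hj
  · have : j < Nat.find h := by
      rw [Nat.lt_find_iff]; exact hj
    rw [List.getElem?_range this]
    obtain ⟨b, hb⟩ := Option.ne_none_iff_exists'.1 (hj j le_rfl)
    simp [hb]
  · rw [← Nat.lt_find_iff h, not_lt] at hj
    simpa using hj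

theorem Tape.content_pre (t : Tape) : t.pre.content = t.content := by
  classical
  have key : ∀ n, t.pre n = none ↔ ∃ m ≤ n, t m = none := by
    intro n
    unfold Tape.pre
    split_ifs with h
    · constructor
      · intro h'; exact ⟨n, le_rfl, h'⟩
      · rintro ⟨m, hm, h'⟩; exact absurd h' (h m hm)
    · push Not at h; simpa using h
  by_cases hex : ∃ n, t n = none
  · have hex' : ∃ n, t.pre n = none := hex.imp fun n hn => (key n).2 ⟨n, le_rfl, hn⟩
    have hfind : Nat.find hex' = Nat.find hex := by
      apply le_antisymm
      · exact Nat.find_min' _ ((key _).2 ⟨_, le_rfl, Nat.find_spec hex⟩)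
      · obtain ⟨m, hm, h⟩ := (key _).1 (Nat.find_spec hex')
        exact (Nat.find_min' hex h).trans hm
    unfold Tape.content
    rw [dif_pos hex, dif_pos hex']
    have e : (List.range (Nat.find hex')).filterMap t.pre
        = (List.range (Nat.find hex)).filterMap t := by
      rw [hfind]
      refine List.filterMap_congr fun i hi => ?_
      rw [List.mem_range, Nat.lt_find_iff] at hi
      unfold Tape.pre
      rw [if_pos hi]
    convert e
  · have hex' : ¬ ∃ n, t.pre n = none := by
      rintro ⟨n, hn⟩
      obtain ⟨m, -, h⟩ := (key n).1 hn
      exact hex ⟨m, h⟩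
    unfold Tape.content
    rw [dif_neg hex, dif_neg hex']

/-- A tape may carry letters behind its first blank that do not belong to its string. A machine that
copies a string must drop them to obtain a genuine input or answer tape. -/
theorem Tape.ofStr_content (t : Tape) (h : ∃ n, t n = none) : Tape.ofStr t.content = t.pre := by
  obtain ⟨s, hs⟩ := t.exists_pre_eq_ofStr h
  rw [← t.content_pre, hs, Tape.content_ofStr]

theorem Tape.ofStr_eq_none {s : Str} {j : ℕ} : Tape.ofStr s j = none ↔ s.length ≤ j := by
  simp [Tape.ofStr]

/-- The unary counter tape with left end marker. -/
def counter (m : ℕ) : Tape := fun j => if j = 0 then some false else if j ≤ m then some true else none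

/-- The maximum covers both the overwriting of an existing mark and the addition of a new one. -/
theorem update_counter (m i : ℕ) :
    Function.update (counter (max m i)) (i + 1) (some true) = counter (max m (i + 1)) := by
  funext j
  rcases eq_or_ne j (i + 1) with rfl | hj
  · simp [counter]
  · rw [Function.update_of_ne hj]
    unfold counter
    congr 1
    congr 1
    simp only [eq_iff_iff]
    omega

theorem counter_eq_none {m j : ℕ} : counter m j = none ↔ m < j := by
  unfold counter
  split_ifs <;> simp <;> omega

theorem counter_eq_false {m j : ℕ} : counter m j = some false ↔ j = 0 := by
  unfold counter
  split_ifs <;> simp_all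

theorem update_blank_eq_counter : Function.update Tape.blank 0 (some false) = counter 0 := by
  funext j
  rcases j with _ | j <;> simp [counter, Tape.blank]

/-! ### Runs of oracle machines -/

namespace OracleTM

attribute [ext] Cfg

variable (M : OracleTM) (φ : Baire)

/-- Some configuration `c'` is reached from `c` after exactly some number `m ≤ n` of steps. -/
def To (n : ℕ) (c c' : M.Cfg) : Prop :=
  ∃ m ≤ n, (M.step φ)^[m] c = c'

variable {M φ}

theorem To.refl (c : M.Cfg) : M.To φ 0 c c := ⟨0, le_rfl, rfl⟩

theorem To.step (c : M.Cfg) : M.To φ 1 c (M.step φ c) := ⟨1, le_rfl, rfl⟩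

theorem To.trans {m n : ℕ} {c c' c'' : M.Cfg} (h : M.To φ m c c') (h' : M.To φ n c' c'') :
    M.To φ (m + n) c c'' := by
  obtain ⟨i, hi, rfl⟩ := h
  obtain ⟨j, hj, rfl⟩ := h'
  refine ⟨i + j, by omega, ?_⟩
  rw [Nat.add_comm i j, Function.iterate_add_apply]

theorem To.mono {m n : ℕ} {c c' : M.Cfg} (h : M.To φ m c c') (hmn : m ≤ n) : M.To φ n c c' := by
  obtain ⟨i, hi, h⟩ := h
  exact ⟨i, hi.trans hmn, h⟩

/-- A loop: a sequence of configurations each of which is reached from the preceding one in one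
step. -/
theorem To.loop {n : ℕ} (c : ℕ → M.Cfg) (h : ∀ i < n, M.step φ (c i) = c (i + 1)) :
    M.To φ n (c 0) (c n) := by
  induction n with
  | zero => exact To.refl _
  | succ n ih =>
    refine (ih fun i hi => h i (by omega)).trans ?_
    rw [← h n (by omega)]
    exact To.step _

theorem step_of_halt {c : M.Cfg} (h : c.state = M.halt) : M.step φ c = c := if_pos h

theorem step_of_query {c : M.Cfg} (h : c.state ≠ M.halt) (h' : c.state = M.query) :
    M.step φ c = M.ask φ c := by
  unfold OracleTM.step
  rw [if_neg h, if_pos h']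

theorem step_of_move {c : M.Cfg} (h : c.state ≠ M.halt) (h' : c.state ≠ M.query) :
    M.step φ c = M.move c := by
  unfold OracleTM.step
  rw [if_neg h, if_neg h']

theorem run_zero (a : Str) : M.run φ a 0 = M.init a := rfl

theorem run_succ (a : Str) (n : ℕ) : M.run φ a (n + 1) = M.step φ (M.run φ a n) := by
  unfold run
  rw [Function.iterate_succ_apply']

theorem run_eq_of_halt {a : Str} {m n : ℕ} (hmn : m ≤ n)
    (h : (M.run φ a m).state = M.halt) : M.run φ a n = M.run φ a m := by
  induction n, hmn using Nat.le_induction with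
  | base => rfl
  | succ n _ ih => rw [run_succ, ih, step_of_halt h]

theorem head_step_le (c : M.Cfg) (k : TapeName M.Work) :
    (M.step φ c).head k ≤ c.head k + 1 := by
  unfold OracleTM.step
  split_ifs
  · omega
  · simp [ask]
  · simp only [move]
    cases ((M.next c.state fun k => c.tape k (c.head k)).2 k).2 <;> simp [Move.apply]
    omega

theorem head_run_le (a : Str) (n : ℕ) (k : TapeName M.Work) : (M.run φ a n).head k ≤ n := by
  induction n with
  | zero => simp [run_zero, init]
  | succ n ih =>
    rw [run_succ]
    exact (head_step_le _ _).trans (by omega)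

/-- The answer tape is excluded because an oracle call changes all of it at once. -/
theorem tape_step_eq (c : M.Cfg) {k : TapeName M.Work} (hk : k ≠ .answer) {j : ℕ}
    (hj : j ≠ c.head k) : (M.step φ c).tape k j = c.tape k j := by
  unfold OracleTM.step
  split_ifs
  · rfl
  · cases k <;> first | rfl | exact absurd rfl hk
  · simp [move, Function.update_of_ne hj]

theorem tape_run_eq (a : Str) (n : ℕ) {k : TapeName M.Work} (hk : k ≠ .answer) {j : ℕ}
    (hj : n ≤ j) : (M.run φ a n).tape k j = (M.init a).tape k j := by
  induction n with
  | zero => rfl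
  | succ n ih =>
    rw [run_succ, tape_step_eq _ hk, ih (by omega)]
    have := head_run_le (M := M) (φ := φ) a n k
    omega

/-- In m' steps no head gets beyond cell m', and only cells before it can have been written, so cell
m' of the output tape is still blank. Halting configurations are fixed, so both hypotheses speak of
the same final configuration. -/
theorem Returns.length_le {a b : Str} {n : ℕ} (h : M.Returns φ a b) (h' : M.HaltsWithin φ a n) :
    b.length ≤ n ∧ ∃ m ≤ n, (M.run φ a m).state = M.halt ∧
      ((M.run φ a m).tape .output).content = b := by
  obtain ⟨m, hm, rfl⟩ := h
  obtain ⟨m', hn, hm'⟩ := h'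
  have e : M.run φ a m = M.run φ a m' := by
    rcases le_total m m' with hle | hle
    · exact (run_eq_of_halt hle hm).symm
    · exact run_eq_of_halt hle hm'
  rw [e]
  refine ⟨(Tape.content_length_le _ (n := m') ?_).trans hn, m', hn, hm', rfl⟩
  rw [tape_run_eq a m' (by simp) le_rfl]
  rfl

theorem To.returns {a b : Str} {n : ℕ} {c : M.Cfg} (h : M.To φ n (M.init a) c)
    (hc : c.state = M.halt) (hb : (c.tape .output).content = b) :
    M.Returns φ a b ∧ M.HaltsWithin φ a n := by
  obtain ⟨m, hm, rfl⟩ := h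
  exact ⟨⟨m, hc, hb⟩, m, hm, hc⟩

end OracleTM

instance (W : Type) [Finite W] : Finite (TapeName W) := by
  refine Finite.of_surjective (α := Fin 4 ⊕ W)
    (fun x => match x with
      | .inl 0 => .input | .inl 1 => .output | .inl 2 => .query | .inl 3 => .answer
      | .inr w => .work w) ?_
  rintro (_ | _ | _ | _ | w)
  exacts [⟨.inl 0, rfl⟩, ⟨.inl 1, rfl⟩, ⟨.inl 2, rfl⟩, ⟨.inl 3, rfl⟩, ⟨.inr w, rfl⟩]

/-! ### A polynomial-time retraction onto the length-monotone functions -/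

/-- The string of `k` zeros. -/
abbrev zeros (k : ℕ) : Str := List.replicate k false

/-- The maximal length of the values of `φ` on strings of at most `n` zeros. -/
def zerosSize (φ : Baire) : ℕ → ℕ
  | 0 => (φ (zeros 0)).length
  | n + 1 => max (zerosSize φ n) (φ (zeros (n + 1))).length

theorem zerosSize_mono (φ : Baire) : Monotone (zerosSize φ) :=
  monotone_nat_of_le_succ fun _ => le_max_left _ _

theorem zerosSize_le_size (φ : Baire) (n : ℕ) : zerosSize φ n ≤ size φ n := by
  induction n with
  | zero => exact length_le_size φ (by simp)
  | succ n ih =>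
    exact max_le (ih.trans (size_mono φ n.le_succ)) (length_le_size φ (by simp))

theorem zerosSize_of_mem_reg {φ : Baire} (h : φ ∈ reg) (n : ℕ) :
    zerosSize φ n = (φ (zeros n)).length := by
  induction n with
  | zero => rfl
  | succ n ih =>
    rw [zerosSize, ih]
    exact max_eq_right (h _ _ (by simp))

/-- The string `s`, truncated or padded with zeros to length `n`. -/
def resize (n : ℕ) (s : Str) : Str := (List.range n).map fun i => s[i]?.getD false

@[simp] theorem length_resize (n : ℕ) (s : Str) : (resize n s).length = n := by simp [resize]

theorem resize_length (s : Str) : resize s.length s = s := by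
  apply List.ext_getElem <;> simp +contextual [resize]

/-- The values of `φ` are truncated or padded so that the result is length-monotone. -/
def regularize (φ : Baire) : Baire := fun a => resize (zerosSize φ a.length) (φ a)

theorem regularize_mem_reg (φ : Baire) : regularize φ ∈ reg := by
  intro a b h
  simpa [regularize] using zerosSize_mono φ h

theorem regularize_of_mem_reg {φ : Baire} (h : φ ∈ reg) : regularize φ = φ := by
  funext a
  have : zerosSize φ a.length = (φ a).length := by
    rw [zerosSize_of_mem_reg h]
    -- Length-monotonicity, used in both directions, makes |φ(a)| depend on |a| only.
    exact le_antisymm (h _ _ (by simp)) (h _ _ (by simp))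
  rw [regularize, this, resize_length]

namespace RegMachine

/-- The states of the machine that computes `regularize`. -/
inductive St : Type
  | boot | ask | walk | rew | next | back | out | halt
  deriving DecidableEq

instance : Fintype St :=
  ⟨{.boot, .ask, .walk, .rew, .next, .back, .out, .halt}, fun s => by cases s <;> decide⟩

/-- A family indexed by the tapes of the machine. The memory tape `true` holds the maximal length
of an answer in unary, the memory tape `false` marks the left end of the input tape. -/
def tup {α : Type} (i o q a w v : α) : TapeName Bool → α
  | .input => i
  | .output => o
  | .query => q
  | .answer => a
  | .work true => w
  | .work false => v

/-- The transition function. -/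
def next (s : St) (σ : TapeName Bool → Symbol) : St × (TapeName Bool → Symbol × Move) :=
  let keep : TapeName Bool → Symbol × Move := fun k => (σ k, .stay)
  match s with
  | .boot => (.ask, tup (keep .input) (keep .output) (keep .query) (keep .answer)
      (some false, .right) (some false, .stay))
  | .walk =>
    -- Every oracle call leads here. The counter head is on cell 1 after a call on zeros, but on the
    -- end marker after the final call on the input; this tells the two apart.
    if σ (.work true) = some false then
      (.out, tup (keep .input) (keep .output) (keep .query) (keep .answer)
        (σ (.work true), .right) (keep (.work false)))
    else if σ .answer = none then
      (.rew, tup (keep .input) (keep .output) (keep .query) (σ .answer, .left)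
        (σ (.work true), .left) (keep (.work false)))
    else
      (.walk, tup (keep .input) (keep .output) (keep .query) (σ .answer, .right)
        (some true, .right) (keep (.work false)))
  | .rew =>
    if σ (.work true) = some false then (.next, keep)
    else (.rew, tup (keep .input) (keep .output) (keep .query) (σ .answer, .left)
        (σ (.work true), .left) (keep (.work false)))
  | .next =>
    -- The input serves as a unary clock for the number of rounds.
    if σ .input = none then
      (.back, tup (σ .input, .left) (keep .output) (σ .query, .left) (keep .answer)
        (keep (.work true)) (σ (.work false), .left))
    else
      (.ask, tup (σ .input, .right) (keep .output) (some false, .right) (keep .answer)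
        (σ (.work true), .right) (σ (.work false), .right))
  | .back => (if σ (.work false) = some false then .ask else .back,
      tup (σ .input, .left) (keep .output) (σ .input, .left) (keep .answer)
        (keep (.work true)) (σ (.work false), .left))
  | .out =>
    if σ (.work true) = none then (.halt, keep)
    else (.out, tup (keep .input) (some ((σ .answer).getD false), .right) (keep .query)
        (σ .answer, .right) (σ (.work true), .right) (keep (.work false)))
  | s => (s, keep)

end RegMachine

open RegMachine in
/-- The machine that computes `regularize`. -/
def regMachine : OracleTM where
  State := St
  Work := Bool
  start := .boot
  halt := .halt
  query := .ask
  resume := .walk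
  next := RegMachine.next

/-! ### Correctness and running time of the regularizing machine -/

namespace RegMachine

/-- A configuration of the machine. -/
def cfg (s : St) (h : TapeName Bool → ℕ) (t : TapeName Bool → Tape) : regMachine.Cfg := ⟨s, h, t⟩

theorem update_zeros (k : ℕ) :
    Function.update (Tape.ofStr (zeros k)) k (some false) = Tape.ofStr (zeros (k + 1)) := by
  funext j
  rcases eq_or_ne j k with rfl | hj
  · simp [Tape.ofStr]
  · rw [Function.update_of_ne hj]
    simp only [Tape.ofStr, List.getElem?_replicate]
    congr 1
    simp only [eq_iff_iff]
    omega

variable {φ : Baire}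

theorem step_cfg {s : St} (hs : s ≠ .halt) (hs' : s ≠ .ask) (h : TapeName Bool → ℕ)
    (t : TapeName Bool → Tape) :
    regMachine.step φ (cfg s h t) =
      cfg (RegMachine.next s fun k => t k (h k)).1
        (fun k => ((RegMachine.next s fun k => t k (h k)).2 k).2.apply (h k))
        (fun k => Function.update (t k) (h k) ((RegMachine.next s fun k => t k (h k)).2 k).1) :=
  OracleTM.step_of_move (c := cfg s h t) hs hs'

theorem cfg_congr {s s' : St} {h : TapeName Bool → ℕ} {t : TapeName Bool → Tape}
    {i o q a w v : ℕ} {ti tp tq ta tw tv : Tape} (hs : s = s')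
    (h1 : h .input = i ∧ h .output = o ∧ h .query = q ∧ h .answer = a ∧ h (.work true) = w ∧
      h (.work false) = v)
    (h2 : t .input = ti ∧ t .output = tp ∧ t .query = tq ∧ t .answer = ta ∧ t (.work true) = tw ∧
      t (.work false) = tv) :
    cfg s h t = cfg s' (tup i o q a w v) (tup ti tp tq ta tw tv) := by
  obtain ⟨rfl, rfl, rfl, rfl, rfl, rfl⟩ := h1
  obtain ⟨rfl, rfl, rfl, rfl, rfl, rfl⟩ := h2
  subst hs
  congr 1 <;> (funext k; rcases k with _ | _ | _ | _ | (_ | _) <;> rfl)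

theorem step_ask (i o q a w v : ℕ) (ti tp tq ta tw tv : Tape) :
    regMachine.step φ (cfg .ask (tup i o q a w v) (tup ti tp tq ta tw tv)) =
      cfg .walk (tup i o q a w v) (tup ti tp tq (Tape.ofStr (φ tq.content)) tw tv) := by
  rw [OracleTM.step_of_query (by simp [cfg, regMachine]) rfl]
  exact cfg_congr rfl ⟨rfl, rfl, rfl, rfl, rfl, rfl⟩ ⟨rfl, rfl, rfl, rfl, rfl, rfl⟩

/-- Answer and counter are traversed in parallel, the counter head one cell ahead because of the end
marker. Both directions take |s| + 1 steps. -/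
theorem measure (i o q v : ℕ) (ti tp tq tv : Tape) (s : Str) (m : ℕ) :
    regMachine.To φ (2 * s.length + 2)
      (cfg .walk (tup i o q 0 1 v) (tup ti tp tq (Tape.ofStr s) (counter m) tv))
      (cfg .next (tup i o q 0 0 v)
        (tup ti tp tq (Tape.ofStr s) (counter (max m s.length)) tv)) := by
  have h1 := OracleTM.To.loop (M := regMachine) (φ := φ) (n := s.length)
    (fun j => cfg .walk (tup i o q j (j + 1) v)
      (tup ti tp tq (Tape.ofStr s) (counter (max m j)) tv)) (by
    intro j hj
    have h1 : counter (max m j) (j + 1) ≠ some false := by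
      unfold counter; split_ifs <;> simp_all
    have h2 : Tape.ofStr s j ≠ none := by rw [Ne, Tape.ofStr_eq_none]; omega
    rw [step_cfg (by simp) (by simp)]
    apply cfg_congr <;>
      simp [RegMachine.next, tup, h1, h2, Move.apply, update_counter])
  -- Truncated subtraction matches the convention at the left end: the answer head waits on cell 0
  -- until the counter head gets there.
  have h2 := OracleTM.To.loop (M := regMachine) (φ := φ) (n := s.length)
    (fun j => cfg .rew (tup i o q (s.length - 1 - j) (s.length - j) v)
      (tup ti tp tq (Tape.ofStr s) (counter (max m s.length)) tv)) (by
    intro j hj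
    have h1 : counter (max m s.length) (s.length - j) ≠ some false := by
      unfold counter; split_ifs <;> first | omega | simp
    rw [step_cfg (by simp) (by simp)]
    apply cfg_congr <;>
      simp [RegMachine.next, tup, h1, Move.apply]
    all_goals omega)
  have h3 : regMachine.step φ (cfg .walk (tup i o q s.length (s.length + 1) v)
      (tup ti tp tq (Tape.ofStr s) (counter (max m s.length)) tv)) =
      cfg .rew (tup i o q (s.length - 1 - 0) (s.length - 0) v)
      (tup ti tp tq (Tape.ofStr s) (counter (max m s.length)) tv) := by
    have h1 : counter (max m s.length) (s.length + 1) ≠ some false := by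
      unfold counter; split_ifs <;> simp_all
    have h2 : Tape.ofStr s s.length = none := by rw [Tape.ofStr_eq_none]
    rw [step_cfg (by simp) (by simp)]
    apply cfg_congr <;> simp [RegMachine.next, tup, h1, h2, Move.apply]
  have h4 : regMachine.step φ (cfg .rew (tup i o q (s.length - 1 - s.length)
      (s.length - s.length) v)
      (tup ti tp tq (Tape.ofStr s) (counter (max m s.length)) tv)) =
      cfg .next (tup i o q 0 0 v)
        (tup ti tp tq (Tape.ofStr s) (counter (max m s.length)) tv) := by
    rw [step_cfg (by simp) (by simp)]
    apply cfg_congr <;> simp [RegMachine.next, tup, counter, Move.apply]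
  simp only [zero_add, Nat.max_zero] at h1
  have := ((h1.trans (h3 ▸ OracleTM.To.step _)).trans h2).trans (h4 ▸ OracleTM.To.step _)
  exact this.mono (by omega)

/-- A round consists of one preparatory step, one oracle call and a measurement of an answer of
length at most `size φ a.length`; this gives the factor. The last answer is irrelevant, since the
next call overwrites it. -/
theorem collect (a : Str) (n : ℕ) (hn : n ≤ a.length) :
    ∃ t, regMachine.To φ ((n + 1) * (2 * size φ a.length + 4)) (regMachine.init a)
      (cfg .next (tup n 0 n 0 0 n) (tup (Tape.ofStr a) Tape.blank (Tape.ofStr (zeros n)) t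
        (counter (zerosSize φ n)) (counter 0))) := by
  induction n with
  | zero =>
    refine ⟨Tape.ofStr (φ (zeros 0)), ?_⟩
    have h0 : regMachine.step φ (regMachine.init a) =
        cfg .ask (tup 0 0 0 0 1 0) (tup (Tape.ofStr a) Tape.blank (Tape.ofStr (zeros 0))
          Tape.blank (counter 0) (counter 0)) := by
      have h1 : Function.update Tape.blank 0 (some false) = counter 0 := by
        funext j; rcases j with _ | j <;> simp [counter, Tape.blank]
      have h2 : Tape.ofStr [] = Tape.blank := by
        funext j; simp [Tape.blank, Tape.ofStr]
      have h3 : regMachine.init a = cfg .boot (tup 0 0 0 0 0 0) (tup (Tape.ofStr a) Tape.blank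
          Tape.blank Tape.blank Tape.blank Tape.blank) :=
        cfg_congr rfl ⟨rfl, rfl, rfl, rfl, rfl, rfl⟩ ⟨rfl, rfl, rfl, rfl, rfl, rfl⟩
      rw [h3, step_cfg (by simp) (by simp)]
      apply cfg_congr <;> simp [RegMachine.next, tup, Move.apply, h1, h2]
    have h1 := OracleTM.To.step (φ := φ) (regMachine.init a)
    rw [h0] at h1
    have h2 := h1.trans (OracleTM.To.step _)
    rw [step_ask, Tape.content_ofStr] at h2
    have h3 := h2.trans (measure ..)
    rw [Nat.zero_max] at h3
    refine h3.mono ?_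
    have := length_le_size φ (a := zeros 0) (n := a.length) (by simp)
    omega
  | succ n ih =>
    obtain ⟨t, ih⟩ := ih (by omega)
    refine ⟨Tape.ofStr (φ (zeros (n + 1))), ?_⟩
    have h1 := ih.trans (OracleTM.To.step _)
    have e : regMachine.step φ (cfg .next (tup n 0 n 0 0 n) (tup (Tape.ofStr a) Tape.blank
          (Tape.ofStr (zeros n)) t (counter (zerosSize φ n)) (counter 0))) =
        cfg .ask (tup (n + 1) 0 (n + 1) 0 1 (n + 1)) (tup (Tape.ofStr a) Tape.blank
          (Tape.ofStr (zeros (n + 1))) t (counter (zerosSize φ n)) (counter 0)) := by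
      have h2 : Tape.ofStr a n ≠ none := by rw [Ne, Tape.ofStr_eq_none]; omega
      rw [step_cfg (by simp) (by simp)]
      apply cfg_congr <;> simp [RegMachine.next, tup, Move.apply, h2, update_zeros]
    rw [e] at h1
    have h2 := h1.trans (OracleTM.To.step _)
    rw [step_ask, Tape.content_ofStr] at h2
    refine (h2.trans (measure ..)).mono ?_
    have := length_le_size φ (a := zeros (n + 1)) (n := a.length) (by simpa using hn)
    nlinarith

/-- The zeros on the query tape are as many as the letters of `a`, so overwriting them from right to
left leaves no residue and rewinds the heads at the same time. -/
theorem copyBack (a : Str) (t : Tape) (m : ℕ) :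
    regMachine.To φ (a.length + 2)
      (cfg .next (tup a.length 0 a.length 0 0 a.length) (tup (Tape.ofStr a) Tape.blank
        (Tape.ofStr (zeros a.length)) t (counter m) (counter 0)))
      (cfg .ask (tup 0 0 0 0 0 0) (tup (Tape.ofStr a) Tape.blank
        (Tape.ofStr a) t (counter m) (counter 0))) := by
  set n := a.length with hn
  let Q : ℕ → Tape := fun i j => if j < n - i then some false else Tape.ofStr a j
  have hQ0 : Q 0 = Tape.ofStr (zeros n) := by
    funext j
    simp only [Q, Tape.ofStr, List.getElem?_replicate, Nat.sub_zero]
    split_ifs with h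
    · rfl
    · simpa using not_lt.1 h
  have hupd : ∀ i, Function.update (Q i) (n - 1 - i) (Tape.ofStr a (n - 1 - i)) = Q (i + 1) := by
    intro i
    funext j
    rcases eq_or_ne j (n - 1 - i) with rfl | hj
    · simp only [Function.update_self, Q]
      rw [if_neg (by omega)]
    · rw [Function.update_of_ne hj]
      simp only [Q]
      congr 1
      simp only [eq_iff_iff]
      omega
  have h1 : regMachine.step φ (cfg .next (tup n 0 n 0 0 n) (tup (Tape.ofStr a) Tape.blank
        (Tape.ofStr (zeros n)) t (counter m) (counter 0))) =
      cfg .back (tup (n - 1 - 0) 0 (n - 1 - 0) 0 0 (n - 1 - 0)) (tup (Tape.ofStr a) Tape.blank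
        (Q 0) t (counter m) (counter 0)) := by
    have h2 : Tape.ofStr a n = none := by rw [Tape.ofStr_eq_none]
    rw [step_cfg (by simp) (by simp)]
    apply cfg_congr <;> simp [RegMachine.next, tup, Move.apply, h2, hQ0]
  -- The last overwriting, on the marked left end, is left to `h3` because it changes the state. For
  -- empty input it writes a blank on a blank.
  have h2 := OracleTM.To.loop (M := regMachine) (φ := φ) (n := n - 1)
    (fun i => cfg .back (tup (n - 1 - i) 0 (n - 1 - i) 0 0 (n - 1 - i)) (tup (Tape.ofStr a)
      Tape.blank (Q i) t (counter m) (counter 0))) (by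
    intro i hi
    have h2 : n - 1 - i ≠ 0 := by omega
    rw [step_cfg (by simp) (by simp)]
    apply cfg_congr <;> simp [RegMachine.next, tup, Move.apply, counter, h2, hupd]
    omega)
  have h3 : regMachine.step φ (cfg .back (tup (n - 1 - (n - 1)) 0 (n - 1 - (n - 1)) 0 0
        (n - 1 - (n - 1))) (tup (Tape.ofStr a) Tape.blank (Q (n - 1)) t (counter m) (counter 0))) =
      cfg .ask (tup 0 0 0 0 0 0) (tup (Tape.ofStr a) Tape.blank
        (Tape.ofStr a) t (counter m) (counter 0)) := by
    have h3 : Function.update (Q (n - 1)) 0 (Tape.ofStr a 0) = Tape.ofStr a := by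
      have := hupd (n - 1)
      rw [Nat.sub_self] at this
      rw [this]
      funext j
      simp only [Q]
      rw [if_neg (by omega)]
    rw [Nat.sub_self, step_cfg (by simp) (by simp)]
    apply cfg_congr <;> simp [RegMachine.next, tup, Move.apply, counter, h3]
  have := ((h1 ▸ OracleTM.To.step _).trans h2).trans (h3 ▸ OracleTM.To.step _)
  exact this.mono (by omega)

/-- The counter alone decides the length of the output; blanks scanned on the answer tape become
zeros. -/
theorem write (a s : Str) (tq tv : Tape) (m : ℕ) :
    regMachine.To φ (m + 2)
      (cfg .walk (tup 0 0 0 0 0 0) (tup (Tape.ofStr a) Tape.blank tq (Tape.ofStr s)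
        (counter m) tv))
      (cfg .halt (tup 0 m 0 m (m + 1) 0) (tup (Tape.ofStr a) (Tape.ofStr (resize m s)) tq
        (Tape.ofStr s) (counter m) tv)) := by
  let O : ℕ → Tape := fun i j => if j < i then some (s[j]?.getD false) else none
  have hO0 : O 0 = Tape.blank := by funext j; simp [O, Tape.blank]
  have hOm : O m = Tape.ofStr (resize m s) := by
    funext j
    simp only [O, Tape.ofStr, resize, List.getElem?_map]
    split_ifs with h
    · simp [List.getElem?_range h]
    · simpa using h
  have hupd : ∀ i, Function.update (O i) i (some (s[i]?.getD false)) = O (i + 1) := by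
    intro i
    funext j
    rcases eq_or_ne j i with rfl | hj
    · simp [O]
    · rw [Function.update_of_ne hj]
      simp only [O]
      congr 1
      simp only [eq_iff_iff]
      omega
  have h1 : regMachine.step φ (cfg .walk (tup 0 0 0 0 0 0) (tup (Tape.ofStr a) Tape.blank tq
        (Tape.ofStr s) (counter m) tv)) =
      cfg .out (tup 0 0 0 0 (0 + 1) 0) (tup (Tape.ofStr a) (O 0) tq (Tape.ofStr s)
        (counter m) tv) := by
    rw [step_cfg (by simp) (by simp)]
    apply cfg_congr <;> simp [RegMachine.next, tup, Move.apply, counter, hO0]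
  have h2 := OracleTM.To.loop (M := regMachine) (φ := φ) (n := m)
    (fun i => cfg .out (tup 0 i 0 i (i + 1) 0) (tup (Tape.ofStr a) (O i) tq (Tape.ofStr s)
        (counter m) tv)) (by
    intro i hi
    have h : counter m (i + 1) ≠ none := by
      unfold counter; split_ifs <;> first | omega | simp
    have h' := hupd i
    rw [step_cfg (by simp) (by simp)]
    apply cfg_congr <;> simp [RegMachine.next, tup, Move.apply, h]
    exact h')
  have h3 : regMachine.step φ (cfg .out (tup 0 m 0 m (m + 1) 0) (tup (Tape.ofStr a) (O m) tq
        (Tape.ofStr s) (counter m) tv)) =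
      cfg .halt (tup 0 m 0 m (m + 1) 0) (tup (Tape.ofStr a) (Tape.ofStr (resize m s)) tq
        (Tape.ofStr s) (counter m) tv) := by
    have h : counter m (m + 1) = none := by
      unfold counter; split_ifs <;> first | omega | rfl
    rw [step_cfg (by simp) (by simp)]
    apply cfg_congr <;> simp [RegMachine.next, tup, Move.apply, h, hOm]
  have := ((h1 ▸ OracleTM.To.step _).trans h2).trans (h3 ▸ OracleTM.To.step _)
  exact this.mono (by omega)

end RegMachine

open RegMachine in
theorem polyTimeComputable_regularize : PolyTimeComputable regularize := by
  have key : ∀ (φ : Baire) (a : Str), regMachine.Returns φ a (regularize φ a) ∧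
      regMachine.HaltsWithin φ a ((a.length + 2) * (2 * size φ a.length + 8)) := by
    intro φ a
    obtain ⟨t, h1⟩ := collect (φ := φ) a a.length le_rfl
    have h2 := (h1.trans (copyBack a t _)).trans (OracleTM.To.step _)
    rw [step_ask, Tape.content_ofStr] at h2
    have h3 := (h2.trans (write a (φ a) _ _ _)).mono
      (n := (a.length + 2) * (2 * size φ a.length + 8)) (by
        have := zerosSize_le_size φ a.length
        nlinarith)
    exact h3.returns rfl (Tape.content_ofStr _)
  refine ⟨regMachine, fun φ a => (key φ a).1, fun l n => (n + 2) * (2 * l n + 8), ?_,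
    fun φ a => (key φ a).2⟩
  exact (IsSecondOrderPoly.id.add (.const 2)).mul
    (((IsSecondOrderPoly.const 2).mul IsSecondOrderPoly.id.app).add (.const 8))

/-! ### Composition of machines -/

/-- The memory tapes of the composition of two machines. The first machine uses the input and the
output tape, and `nq`, `na`, `nw` in place of its other tapes. The second machine uses the query
tape, and `ri`, `ro`, `rw` in place of its other tapes, where `ra` takes the role of the answer tape
until the first query. The heads of `mq` and `ma` follow those of `nq` and `na`. -/
inductive CompWork (V W : Type) : Type
  | nq | na | nw (v : V) | ri | ro | ra | rw (w : W) | mq | ma | clk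

instance (V W : Type) [Finite V] [Finite W] : Finite (CompWork V W) := by
  refine Finite.of_surjective (α := Fin 8 ⊕ (V ⊕ W))
    (fun x => match x with
      | .inl 0 => .nq | .inl 1 => .na | .inl 2 => .ri | .inl 3 => .ro | .inl 4 => .ra
      | .inl 5 => .mq | .inl 6 => .ma | .inl 7 => .clk
      | .inr (.inl v) => .nw v | .inr (.inr w) => .rw w) ?_
  rintro (_ | _ | v | _ | _ | _ | w | _ | _ | _)
  exacts [⟨.inl 0, rfl⟩, ⟨.inl 1, rfl⟩, ⟨.inr (.inl v), rfl⟩, ⟨.inl 2, rfl⟩, ⟨.inl 3, rfl⟩,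
    ⟨.inl 4, rfl⟩, ⟨.inr (.inr w), rfl⟩, ⟨.inl 5, rfl⟩, ⟨.inl 6, rfl⟩, ⟨.inl 7, rfl⟩]

/-- The states of the composition of two machines. -/
inductive CompState (S T : Type) : Type
  | boot
  | ask
  | nrun (s : S)
  | rrun (s : T) (f : Bool)
  | rew (p : Fin 4)
  | cin (b : Bool)
  | cout (b : Bool)
  | restore

instance (S T : Type) [Finite S] [Finite T] : Finite (CompState S T) := by
  refine Finite.of_surjective (α := Fin 3 ⊕ (S ⊕ (T × Bool)) ⊕ (Fin 4 ⊕ (Bool ⊕ Bool)))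
    (fun x => match x with
      | .inl 0 => .boot | .inl 1 => .ask | .inl 2 => .restore
      | .inr (.inl (.inl s)) => .nrun s | .inr (.inl (.inr s)) => .rrun s.1 s.2
      | .inr (.inr (.inl p)) => .rew p | .inr (.inr (.inr (.inl b))) => .cin b
      | .inr (.inr (.inr (.inr b))) => .cout b) ?_
  rintro (_ | _ | s | ⟨s, f⟩ | p | b | b | _)
  exacts [⟨.inl 0, rfl⟩, ⟨.inl 1, rfl⟩, ⟨.inr (.inl (.inl s)), rfl⟩,
    ⟨.inr (.inl (.inr (s, f))), rfl⟩, ⟨.inr (.inr (.inl p)), rfl⟩,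
    ⟨.inr (.inr (.inr (.inl b))), rfl⟩, ⟨.inr (.inr (.inr (.inr b))), rfl⟩, ⟨.inl 2, rfl⟩]

namespace CompMachine

/-- A family indexed by the tapes of the composition of two machines, sorted by the machine: the
tapes of the first machine, the tapes of the second machine, the answer tape, the tapes that mark
head positions of the query and the answer tape of the first machine, and the clock. -/
@[ext]
structure Parts (V W α : Type) where
  n : TapeName V → α
  r : TapeName W → α
  x : α
  q : α
  a : α
  c : α

/-- The family as a function on the tapes. -/
def Parts.toFun {V W α : Type} (p : Parts V W α) : TapeName (CompWork V W) → α
  | .input => p.n .input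
  | .output => p.n .output
  | .query => p.r .query
  | .answer => p.x
  | .work .nq => p.n .query
  | .work .na => p.n .answer
  | .work (.nw v) => p.n (.work v)
  | .work .ri => p.r .input
  | .work .ro => p.r .output
  | .work .ra => p.r .answer
  | .work (.rw w) => p.r (.work w)
  | .work .mq => p.q
  | .work .ma => p.a
  | .work .clk => p.c

/-- The inverse of `Parts.toFun`. -/
def Parts.ofFun {V W α : Type} (g : TapeName (CompWork V W) → α) : Parts V W α where
  n
    | .input => g .input
    | .output => g .output
    | .query => g (.work .nq)
    | .answer => g (.work .na)
    | .work v => g (.work (.nw v))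
  r
    | .input => g (.work .ri)
    | .output => g (.work .ro)
    | .query => g .query
    | .answer => g (.work .ra)
    | .work w => g (.work (.rw w))
  x := g .answer
  q := g (.work .mq)
  a := g (.work .ma)
  c := g (.work .clk)

/-- The symbols that are scanned by the heads. -/
def read {V W : Type} (h : Parts V W ℕ) (t : Parts V W Tape) : Parts V W Symbol where
  n k := t.n k (h.n k)
  r k := t.r k (h.r k)
  x := t.x h.x
  q := t.q h.q
  a := t.a h.a
  c := t.c h.c

/-- Head positions after the head moves. -/
def moveHeads {V W : Type} (p : Parts V W (Symbol × Move)) (h : Parts V W ℕ) : Parts V W ℕ where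
  n k := (p.n k).2.apply (h.n k)
  r k := (p.r k).2.apply (h.r k)
  x := p.x.2.apply h.x
  q := p.q.2.apply h.q
  a := p.a.2.apply h.a
  c := p.c.2.apply h.c

/-- Tapes after writing. -/
def writeTapes {V W : Type} (p : Parts V W (Symbol × Move)) (h : Parts V W ℕ)
    (t : Parts V W Tape) : Parts V W Tape where
  n k := Function.update (t.n k) (h.n k) (p.n k).1
  r k := Function.update (t.r k) (h.r k) (p.r k).1
  x := Function.update t.x h.x p.x.1
  q := Function.update t.q h.q p.q.1
  a := Function.update t.a h.a p.a.1
  c := Function.update t.c h.c p.c.1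

/-- Replacing the entry at the answer tape. -/
def withAnswer {W α : Type} (g : TapeName W → α) (y : α) : TapeName W → α
  | .answer => y
  | k => g k

/-- Changing the entries at the query and the answer tape. -/
def mapQA {V α : Type} (f : α → α) (g : TapeName V → α) : TapeName V → α
  | .query => f (g .query)
  | .answer => f (g .answer)
  | k => g k

/-- The action without effect. -/
def keep (s : Symbol) : Symbol × Move := (s, .stay)

/-- The head move that is reset to the position of a mark. -/
def seek (s : Symbol) : Move := if s = some true then .stay else .right

variable {N R : OracleTM}

/-- The action without effect on all tapes. -/
def keepAll {V W : Type} (σ : Parts V W Symbol) : Parts V W (Symbol × Move) where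
  n k := keep (σ.n k)
  r k := keep (σ.r k)
  x := keep σ.x
  q := keep σ.q
  a := keep σ.a
  c := keep σ.c

/-- The action that moves the heads of all but the input, output and memory tapes of the first
machine. -/
def sweep {V W : Type} (m : Move) (σ : Parts V W Symbol) : Parts V W (Symbol × Move) where
  n := mapQA (fun p => (p.1, m)) fun k => keep (σ.n k)
  r k := (σ.r k, m)
  x := (σ.x, m)
  q := (σ.q, m)
  a := (σ.a, m)
  c := (σ.c, m)

/-- The state after a rewinding phase. -/
def after (N R : OracleTM) : Fin 4 → CompState N.State R.State
  | 0 => .cin true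
  | 1 => .rrun R.start false
  | 2 => .cout true
  | 3 => .restore

/-- The transition function. -/
def next (s : CompState N.State R.State) (σ : Parts N.Work R.Work Symbol) :
    CompState N.State R.State × Parts N.Work R.Work (Symbol × Move) :=
  match s with
  | .boot => (.nrun N.start, { keepAll σ with c := (some false, .right) })
  | .ask => (.ask, keepAll σ)
  | .nrun s =>
    -- The marks preserve the positions of the query and answer heads of `N`, which the copying will
    -- move.
    if s = N.query then
      (.rew 0, { keepAll σ with q := (some true, .stay), a := (some true, .stay) })
    else
      (.nrun (N.next s σ.n).1,
        { keepAll σ with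
          n := (N.next s σ.n).2
          q := (σ.q, ((N.next s σ.n).2 .query).2)
          a := (σ.a, ((N.next s σ.n).2 .answer).2)
          c := (some true, .right) })
  | .rew p => if σ.c = some false then (after N R p, keepAll σ) else (.rew p, sweep .left σ)
  | .cin b =>
    if σ.c = none then (.rew 1, keepAll σ)
    else
      (.cin (b && (σ.n .query).isSome),
        { sweep .right σ with
          r := fun k => match k with
            | .input => (bif b then σ.n .query else none, .right)
            | _ => (none, .right) })
  | .rrun s f =>
    if s = R.halt then (.rew 2, keepAll σ)
    else
      -- A simulation of `R` starts with the clock head on the end marker, which must survive.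
      let tick : Symbol × Move := (if σ.c = some false then some false else some true, .right)
      if s = R.query then (.ask, { keepAll σ with c := tick })
      else
        -- The true answer tape may still hold an old answer whose length the clock does not bound,
        -- while `R` expects a blank tape. Instead of erasing it, `ra` stands in until a call
        -- overwrites it.
        let ρ := R.next s (bif f then withAnswer σ.r σ.x else σ.r)
        (.rrun ρ.1 f,
          { keepAll σ with
            r := bif f then withAnswer ρ.2 (σ.r .answer, (ρ.2 .answer).2) else ρ.2
            x := bif f then ρ.2 .answer else (σ.x, (ρ.2 .answer).2)
            c := tick })
  | .cout b =>
    if σ.c = none then (.rew 3, keepAll σ)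
    else
      (.cout (b && (σ.r .output).isSome),
        { sweep .right σ with
          n := withAnswer (sweep .right σ).n (bif b then σ.r .output else none, .right) })
  | .restore =>
    if σ.c = none then
      (.nrun N.resume, { keepAll σ with q := (none, .stay), a := (none, .stay) })
    else
      (.restore,
        { keepAll σ with
          n := fun k => match k with
            | .query => (σ.n .query, seek σ.q)
            | .answer => (σ.n .answer, seek σ.a)
            | k => keep (σ.n k)
          q := (σ.q, seek σ.q)
          a := (σ.a, seek σ.a)
          c := (σ.c, .right) })

end CompMachine

open CompMachine in
/-- The composition of two machines: the machine `N` is simulated, and its oracle queries are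
answered with a simulation of `R`. -/
noncomputable def comp (N R : OracleTM) : OracleTM where
  State := CompState N.State R.State
  decState := Classical.decEq _
  Work := CompWork N.Work R.Work
  start := .boot
  halt := .nrun N.halt
  query := .ask
  resume := .rrun R.resume true
  next s σ := ((CompMachine.next s (Parts.ofFun σ)).1, (CompMachine.next s (Parts.ofFun σ)).2.toFun)

/-! ### Correctness and running time of the composition -/

namespace CompMachine

variable {N R : OracleTM} {φ : Baire}

/-- A configuration of the composition of two machines. -/
def cfg (s : CompState N.State R.State) (h : Parts N.Work R.Work ℕ)
    (t : Parts N.Work R.Work Tape) : (comp N R).Cfg := ⟨s, h.toFun, t.toFun⟩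

theorem step_cfg {s : CompState N.State R.State} (hs : s ≠ .nrun N.halt) (hs' : s ≠ .ask)
    (h : Parts N.Work R.Work ℕ) (t : Parts N.Work R.Work Tape) :
    (comp N R).step φ (cfg s h t) =
      cfg (next s (read h t)).1 (moveHeads (next s (read h t)).2 h)
        (writeTapes (next s (read h t)).2 h t) := by
  rw [OracleTM.step_of_move (c := cfg s h t) hs hs']
  have e : Parts.ofFun (fun k => t.toFun k (h.toFun k)) = read h t := by
    ext k
    · cases k <;> rfl
    · cases k <;> rfl
    all_goals rfl
  apply OracleTM.Cfg.ext
  · exact congrArg (fun σ => (next s σ).1) e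
  · funext k
    refine (congrArg (fun σ => (((next s σ).2.toFun k).2).apply (h.toFun k)) e).trans ?_
    rcases k with _ | _ | _ | _ | (_ | _ | _ | _ | _ | _ | _ | _ | _ | _) <;> rfl
  · funext k
    refine (congrArg (fun σ => Function.update (t.toFun k) (h.toFun k)
      ((next s σ).2.toFun k).1) e).trans ?_
    rcases k with _ | _ | _ | _ | (_ | _ | _ | _ | _ | _ | _ | _ | _ | _) <;> rfl

theorem step_ask (h : Parts N.Work R.Work ℕ) (t : Parts N.Work R.Work Tape) :
    (comp N R).step φ (cfg .ask h t) =
      cfg (.rrun R.resume true) h { t with x := Tape.ofStr (φ (t.r .query).content) } := by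
  rw [OracleTM.step_of_query (by simp [cfg, comp]) rfl]
  apply OracleTM.Cfg.ext
  · rfl
  · rfl
  · funext k
    rcases k with _ | _ | _ | _ | (_ | _ | _ | _ | _ | _ | _ | _ | _ | _) <;> rfl

theorem writeTapes_keepAll (h : Parts N.Work R.Work ℕ) (t : Parts N.Work R.Work Tape) :
    writeTapes (keepAll (read h t)) h t = t := by
  ext <;> simp [writeTapes, keepAll, keep, read]

theorem moveHeads_keepAll (h : Parts N.Work R.Work ℕ) (σ : Parts N.Work R.Work Symbol) :
    moveHeads (keepAll σ) h = h := rfl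

theorem writeTapes_sweep (m : Move) (h : Parts N.Work R.Work ℕ) (t : Parts N.Work R.Work Tape) :
    writeTapes (sweep m (read h t)) h t = t := by
  ext k
  · cases k <;> simp [writeTapes, sweep, keep, read, mapQA]
  all_goals simp [writeTapes, sweep, read]

/-- Changing the head positions of all but the input, output and memory tapes of the first
machine. -/
def mapHeads (f : ℕ → ℕ) (h : Parts N.Work R.Work ℕ) : Parts N.Work R.Work ℕ where
  n := mapQA f h.n
  r k := f (h.r k)
  x := f h.x
  q := f h.q
  a := f h.a
  c := f h.c

theorem moveHeads_sweep (m : Move) (h : Parts N.Work R.Work ℕ)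
    (σ : Parts N.Work R.Work Symbol) : moveHeads (sweep m σ) h = mapHeads m.apply h := by
  ext k
  · cases k <;> rfl
  all_goals rfl

theorem mapHeads_mapHeads (f g : ℕ → ℕ) (h : Parts N.Work R.Work ℕ) :
    mapHeads f (mapHeads g h) = mapHeads (f ∘ g) h := by
  ext k
  · cases k <;> rfl
  all_goals rfl

theorem mapHeads_id (h : Parts N.Work R.Work ℕ) : mapHeads (fun i => i) h = h := by
  ext k
  · cases k <;> rfl
  all_goals rfl

theorem mapHeads_congr {f g : ℕ → ℕ} {h : Parts N.Work R.Work ℕ} (e : ∀ i ≤ h.c, f i = g i)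
    (hq : h.n .query ≤ h.c) (ha : h.n .answer ≤ h.c) (hr : ∀ k, h.r k ≤ h.c) (hx : h.x ≤ h.c)
    (hmq : h.q ≤ h.c) (hma : h.a ≤ h.c) : mapHeads f h = mapHeads g h := by
  ext k
  · cases k <;> simp [mapHeads, mapQA, e _ hq, e _ ha]
  · exact e _ (hr k)
  exacts [e _ hx, e _ hmq, e _ hma, e _ le_rfl]

/-- No moving head is to the right of the clock head, so all have reached cell 0 when the clock head
meets its end marker. -/
theorem rewind (p : Fin 4) (h : Parts N.Work R.Work ℕ) (t : Parts N.Work R.Work Tape) {m : ℕ}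
    (hc : t.c = counter m)
    (hq : h.n .query ≤ h.c) (ha : h.n .answer ≤ h.c) (hr : ∀ k, h.r k ≤ h.c) (hx : h.x ≤ h.c)
    (hmq : h.q ≤ h.c) (hma : h.a ≤ h.c) :
    (comp N R).To φ (h.c + 1) (cfg (.rew p) h t)
      (cfg (after N R p) (mapHeads (fun _ => 0) h) t) := by
  have h1 := OracleTM.To.loop (M := comp N R) (φ := φ) (n := h.c)
    (fun i => cfg (.rew p) (mapHeads (· - i) h) t) (by
    intro i hi
    have h1 : t.c (h.c - i) ≠ some false := by rw [hc, Ne, counter_eq_false]; omega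
    have h2 : next (.rew p) (read (mapHeads (· - i) h) t) =
        ((.rew p : CompState N.State R.State), sweep .left (read (mapHeads (· - i) h) t)) :=
      if_neg h1
    rw [step_cfg (by simp) (by simp), h2, writeTapes_sweep, moveHeads_sweep, mapHeads_mapHeads]
    rfl)
  have h2 : (comp N R).step φ (cfg (.rew p) (mapHeads (· - h.c) h) t) =
      cfg (after N R p) (mapHeads (fun _ => 0) h) t := by
    have h1 : t.c (h.c - h.c) = some false := by rw [hc, counter_eq_false]; omega
    have h2 : next (.rew p) (read (mapHeads (· - h.c) h) t) =
        (after N R p, keepAll (read (mapHeads (· - h.c) h) t)) :=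
      if_pos h1
    rw [step_cfg (by simp) (by simp), h2, writeTapes_keepAll, moveHeads_keepAll]
    congr 1
    exact mapHeads_congr (fun i hi => Nat.sub_eq_zero_of_le hi) hq ha hr hx hmq hma
  rw [show (fun i => i - 0) = fun i : ℕ => i from rfl] at h1
  rw [mapHeads_id] at h1
  exact h1.trans (h2 ▸ OracleTM.To.step _)

/-- Whether the first cells of a tape carry letters. -/
def allSome (t : Tape) : ℕ → Bool
  | 0 => true
  | i + 1 => allSome t i && (t i).isSome

theorem allSome_iff (t : Tape) (i : ℕ) : allSome t i = true ↔ ∀ j < i, t j ≠ none := by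
  induction i with
  | zero => simp [allSome]
  | succ i ih =>
    simp only [allSome, Bool.and_eq_true, ih, Nat.lt_succ_iff_lt_or_eq, Option.isSome_iff_ne_none]
    constructor
    · rintro ⟨h, h'⟩ j (hj | rfl)
      exacts [h j hj, h']
    · exact fun h => ⟨fun j hj => h j (.inl hj), h i (.inr rfl)⟩

/-- One bit of the finite control, recording whether a blank has been seen, suffices to copy exactly
the string on a tape. -/
theorem cond_allSome (t : Tape) (i : ℕ) : (bif allSome t i then t i else none) = t.pre i := by
  classical
  unfold Tape.pre
  by_cases h : allSome t i = true
  · rw [h, cond_true]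
    rw [allSome_iff] at h
    by_cases h' : t i = none
    · rw [h', ite_self]
    · rw [if_pos]
      intro j hj
      rcases hj.lt_or_eq with hj | rfl
      exacts [h j hj, h']
  · rw [if_neg, Bool.eq_false_of_not_eq_true h, cond_false]
    exact fun h' => h ((allSome_iff t i).2 fun j hj => h' j hj.le)

/-- The tape `s` on the first `i` cells and the tape `t` elsewhere. -/
def mix (i : ℕ) (s t : Tape) : Tape := fun j => if j < i then s j else t j

theorem mix_eq_left {i : ℕ} {s t : Tape} (h : ∀ j ≥ i, s j = t j) : mix i s t = s := by
  funext j
  unfold mix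
  split_ifs with hj
  · rfl
  · exact (h j (not_lt.1 hj)).symm

theorem update_mix (i : ℕ) (s t : Tape) :
    Function.update (mix i s t) i (s i) = mix (i + 1) s t := by
  funext j
  rcases eq_or_ne j i with rfl | hj
  · simp [mix]
  · rw [Function.update_of_ne hj]
    unfold mix
    congr 1
    simp only [eq_iff_iff]
    omega

theorem pre_eq_none {t : Tape} {j : ℕ} (h : t j = none) : t.pre j = none := by
  unfold Tape.pre
  rw [h, ite_self]

/-- The tapes of the second machine in the course of the copying of its input. -/
noncomputable def cinTapes (i : ℕ) (s : Tape) (t : TapeName R.Work → Tape) : TapeName R.Work → Tape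
  | .input => mix i s.pre (t .input)
  | k => mix i Tape.blank (t k)

/-- The tapes with `s` on the input tape and blank otherwise. -/
def inputTapes {W : Type} (s : Tape) : TapeName W → Tape
  | .input => s
  | _ => Tape.blank

/-- The clock bounds all cells in use, so a single pass both transfers the query and erases what an
earlier simulation of `R` left behind. -/
theorem copyIn (h : Parts N.Work R.Work ℕ) (t : Parts N.Work R.Work Tape) {m : ℕ}
    (hc : t.c = counter m) (hq : ∀ j > m, t.n .query j = none) (hr : ∀ k, ∀ j > m, t.r k j = none) :
    (comp N R).To φ (m + 2) (cfg (.cin true) (mapHeads (fun _ => 0) h) t)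
      (cfg (.rew 1) (mapHeads (fun _ => m + 1) h)
        { t with r := inputTapes (t.n .query).pre }) := by
  have h1 := OracleTM.To.loop (M := comp N R) (φ := φ) (n := m + 1)
    (fun i => cfg (.cin (allSome (t.n .query) i)) (mapHeads (fun _ => i) h)
      { t with r := cinTapes i (t.n .query) t.r }) (by
    intro i hi
    have h1 : ¬ t.c i = none := by rw [hc, counter_eq_none]; omega
    rw [step_cfg (by simp) (by simp)]
    simp only [next, read, mapHeads, mapQA, if_neg h1, cond_allSome]
    congr 1
    · ext k
      · cases k <;> rfl
      · cases k <;> rfl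
      all_goals rfl
    · ext1
      · funext k
        cases k <;> simp [writeTapes, sweep, keep, mapQA]
      · funext k
        cases k
        · exact update_mix ..
        all_goals exact update_mix i Tape.blank _
      all_goals simp [writeTapes, sweep])
  have h2 : (comp N R).step φ (cfg (.cin (allSome (t.n .query) (m + 1)))
      (mapHeads (fun _ => m + 1) h) { t with r := cinTapes (m + 1) (t.n .query) t.r }) =
      cfg (.rew 1) (mapHeads (fun _ => m + 1) h)
        { t with r := inputTapes (t.n .query).pre } := by
    have h1 : t.c (m + 1) = none := by rw [hc, counter_eq_none]; omega
    rw [step_cfg (by simp) (by simp)]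
    have h3 : next (.cin (allSome (t.n .query) (m + 1))) (read (mapHeads (fun _ => m + 1) h)
        { t with r := cinTapes (m + 1) (t.n .query) t.r }) = ((.rew 1 : CompState N.State R.State),
        keepAll (read (mapHeads (fun _ => m + 1) h)
          { t with r := cinTapes (m + 1) (t.n .query) t.r })) := if_pos h1
    rw [h3, writeTapes_keepAll, moveHeads_keepAll]
    congr 2
    funext k
    cases k
    · refine mix_eq_left fun j hj => ?_
      rw [hr _ j hj, pre_eq_none (hq j hj)]
    all_goals exact mix_eq_left fun j hj => (hr _ j hj).symm
  have h0 : cinTapes 0 (t.n .query) t.r = t.r := by funext k; cases k <;> rfl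
  simp only [h0] at h1
  exact h1.trans (h2 ▸ OracleTM.To.step _)

/-- The pass extends over the old answer too, so that, as in an oracle call, nothing of it remains.
-/
theorem copyOut (h : Parts N.Work R.Work ℕ) (t : Parts N.Work R.Work Tape) {m : ℕ}
    (hc : t.c = counter m) (ha : ∀ j > m, t.n .answer j = none)
    (ho : ∀ j > m, t.r .output j = none) :
    (comp N R).To φ (m + 2) (cfg (.cout true) (mapHeads (fun _ => 0) h) t)
      (cfg (.rew 3) (mapHeads (fun _ => m + 1) h)
        { t with n := withAnswer t.n (t.r .output).pre }) := by
  have h1 := OracleTM.To.loop (M := comp N R) (φ := φ) (n := m + 1)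
    (fun i => cfg (.cout (allSome (t.r .output) i)) (mapHeads (fun _ => i) h)
      { t with n := withAnswer t.n (mix i (t.r .output).pre (t.n .answer)) }) (by
    intro i hi
    have h1 : ¬ t.c i = none := by rw [hc, counter_eq_none]; omega
    rw [step_cfg (by simp) (by simp)]
    simp only [next, read, mapHeads, if_neg h1, cond_allSome]
    congr 1
    · ext k
      · cases k <;> rfl
      · cases k <;> rfl
      all_goals rfl
    · ext1
      · funext k
        cases k
        case answer => exact update_mix ..
        all_goals simp [writeTapes, sweep, keep, mapQA, withAnswer]
      all_goals simp [writeTapes, sweep])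
  have h2 : (comp N R).step φ (cfg (.cout (allSome (t.r .output) (m + 1)))
      (mapHeads (fun _ => m + 1) h)
      { t with n := withAnswer t.n (mix (m + 1) (t.r .output).pre (t.n .answer)) }) =
      cfg (.rew 3) (mapHeads (fun _ => m + 1) h)
        { t with n := withAnswer t.n (t.r .output).pre } := by
    have h1 : t.c (m + 1) = none := by rw [hc, counter_eq_none]; omega
    rw [step_cfg (by simp) (by simp)]
    have h3 : next (.cout (allSome (t.r .output) (m + 1))) (read (mapHeads (fun _ => m + 1) h)
        { t with n := withAnswer t.n (mix (m + 1) (t.r .output).pre (t.n .answer)) }) =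
        ((.rew 3 : CompState N.State R.State), keepAll (read (mapHeads (fun _ => m + 1) h)
          { t with n := withAnswer t.n (mix (m + 1) (t.r .output).pre (t.n .answer)) })) :=
      if_pos h1
    rw [h3, writeTapes_keepAll, moveHeads_keepAll, mix_eq_left]
    intro j hj
    rw [ha j hj, pre_eq_none (ho j hj)]
  have h0 : withAnswer t.n (mix 0 (t.r .output).pre (t.n .answer)) = t.n := by
    funext k; cases k <;> rfl
  simp only [h0] at h1
  exact h1.trans (h2 ▸ OracleTM.To.step _)

/-- The tape that carries a mark in cell `i` only. -/
def markTape (i : ℕ) : Tape := Function.update Tape.blank i (some true)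

theorem seek_markTape (i h : ℕ) : (seek (markTape h (min i h))).apply (min i h) = min (i + 1) h := by
  unfold seek markTape
  rcases lt_or_ge i h with hi | hi
  · rw [min_eq_left hi.le, min_eq_left hi, Function.update_of_ne hi.ne]
    rfl
  · rw [min_eq_right hi, Function.update_self, min_eq_right (by omega)]
    rfl

/-- Setting the query and the answer entry. -/
def setQA {V α : Type} (q a : α) (g : TapeName V → α) : TapeName V → α
  | .query => q
  | .answer => a
  | k => g k

/-- Each head runs right in parallel with the head on its mark tape and stops at the mark; after i
steps it is at the minimum of i and its target. -/
theorem restoreHeads (n : TapeName N.Work → ℕ) (t : Parts N.Work R.Work Tape) {m : ℕ}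
    (hc : t.c = counter m) (hq : n .query ≤ m + 1) (ha : n .answer ≤ m + 1)
    (htq : t.q = markTape (n .query)) (hta : t.a = markTape (n .answer)) :
    (comp N R).To φ (m + 2) (cfg .restore ⟨mapQA (fun _ => 0) n, fun _ => 0, 0, 0, 0, 0⟩ t)
      (cfg (.nrun N.resume) ⟨n, fun _ => 0, 0, n .query, n .answer, m + 1⟩
        { t with q := Tape.blank, a := Tape.blank }) := by
  have h1 := OracleTM.To.loop (M := comp N R) (φ := φ) (n := m + 1)
    (fun i => cfg .restore ⟨setQA (min i (n .query)) (min i (n .answer)) n, fun _ => 0, 0,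
      min i (n .query), min i (n .answer), i⟩ t) (by
    intro i hi
    have h1 : ¬ t.c i = none := by rw [hc, counter_eq_none]; omega
    rw [step_cfg (by simp) (by simp)]
    simp only [next, read, if_neg h1, htq, hta]
    congr 1
    · ext k
      · cases k
        case query => exact seek_markTape ..
        case answer => exact seek_markTape ..
        all_goals rfl
      exacts [rfl, rfl, seek_markTape .., seek_markTape .., rfl]
    · ext1
      · funext k
        cases k <;> simp [writeTapes, keep]
      all_goals simp [writeTapes, keepAll, keep, htq, hta])
  have h2 : (comp N R).step φ (cfg .restore ⟨setQA (min (m + 1) (n .query))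
      (min (m + 1) (n .answer)) n, fun _ => 0, 0,
      min (m + 1) (n .query), min (m + 1) (n .answer), m + 1⟩ t) =
      cfg (.nrun N.resume) ⟨n, fun _ => 0, 0, n .query, n .answer, m + 1⟩
        { t with q := Tape.blank, a := Tape.blank } := by
    have h1 : t.c (m + 1) = none := by rw [hc, counter_eq_none]; omega
    have e : ∀ i, Function.update (markTape i) i none = Tape.blank := by
      intro i
      unfold markTape
      rw [Function.update_idem]
      exact Function.update_eq_self i Tape.blank
    rw [step_cfg (by simp) (by simp)]
    simp only [next, read, if_pos h1, htq, hta, min_eq_right hq, min_eq_right ha]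
    congr 1
    · ext k
      · cases k <;> rfl
      all_goals rfl
    · ext1 <;> simp [writeTapes, keepAll, keep, htq, hta, e]
  have h0 : setQA 0 0 n = mapQA (fun _ => 0) n := by
    funext k; cases k <;> rfl
  simp only [Nat.zero_min, h0] at h1
  exact h1.trans (h2 ▸ OracleTM.To.step _)

/-- Before step i the rightmost cell visited is i - 1. For i = 0 the truncated subtraction is
harmless, as the end marker is merely rewritten. -/
theorem tick_counter (m i : ℕ) :
    Function.update (counter (max m (i - 1))) i
      (if counter (max m (i - 1)) i = some false then some false else some true) =
      counter (max m i) := by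
  rcases i with _ | i
  · rw [if_pos (counter_eq_false.2 rfl), Function.update_eq_self_iff]
    rfl
  · rw [if_neg (by rw [counter_eq_false]; omega)]
    exact update_counter m i

/-- The flag selects the tape that plays the answer tape of `R`; an oracle call sets it, whatever
was there before. A call takes two steps, as the clock is advanced first. Blankness of `ra` is
tracked separately because the configuration of `R` no longer determines it once the flag is set. -/
theorem simulate_step {d : R.Cfg} (hd : d.state ≠ R.halt) {f : Bool}
    {hn : TapeName N.Work → ℕ} {hq ha i m : ℕ} {tn : TapeName N.Work → Tape}
    {tr : TapeName R.Work → Tape} {tx tq ta : Tape}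
    (ht : (bif f then withAnswer tr tx else tr) = d.tape) (hi : d.head .answer ≤ i)
    (hra : ∀ j > max m (i - 1), tr .answer j = none) :
    ∃ f' tr' tx', (comp N R).To φ 2
      (cfg (.rrun d.state f) ⟨hn, d.head, d.head .answer, hq, ha, i⟩
        ⟨tn, tr, tx, tq, ta, counter (max m (i - 1))⟩)
      (cfg (.rrun (R.step φ d).state f')
        ⟨hn, (R.step φ d).head, (R.step φ d).head .answer, hq, ha, i + 1⟩
        ⟨tn, tr', tx', tq, ta, counter (max m i)⟩) ∧
      (bif f' then withAnswer tr' tx' else tr') = (R.step φ d).tape ∧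
      ∀ j > max m i, tr' .answer j = none := by
  by_cases hs : d.state = R.query
  · have h1 : (comp N R).step φ (cfg (.rrun d.state f) ⟨hn, d.head, d.head .answer, hq, ha, i⟩
        ⟨tn, tr, tx, tq, ta, counter (max m (i - 1))⟩) =
        cfg .ask ⟨hn, d.head, d.head .answer, hq, ha, i + 1⟩
        ⟨tn, tr, tx, tq, ta, counter (max m i)⟩ := by
      rw [step_cfg (by simp) (by simp)]
      simp only [next, if_neg hd, if_pos hs, read]
      congr 1
      ext1 <;> simp [writeTapes, keepAll, keep]
      exact tick_counter m i
    have h2 := OracleTM.To.step (φ := φ) (cfg (N := N) (R := R) (.rrun d.state f)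
      ⟨hn, d.head, d.head .answer, hq, ha, i⟩ ⟨tn, tr, tx, tq, ta, counter (max m (i - 1))⟩)
    rw [h1] at h2
    have h3 := h2.trans (OracleTM.To.step _)
    rw [step_ask] at h3
    have e : tr .query = d.tape .query := by rw [← ht]; cases f <;> rfl
    rw [OracleTM.step_of_query hd hs]
    refine ⟨true, tr, _, h3, ?_, fun j hj => hra j (by omega)⟩
    funext k
    have : ∀ k ≠ .answer, tr k = d.tape k := by
      intro k hk
      rw [← ht]
      cases f
      · rfl
      · cases k <;> first | rfl | exact absurd rfl hk
    cases k
    case answer => simp [withAnswer, OracleTM.ask, e]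
    all_goals exact this _ (by simp)
  · have key : (bif f then withAnswer (fun k => tr k (d.head k)) (tx (d.head .answer))
        else fun k => tr k (d.head k)) = fun k => d.tape k (d.head k) := by
      rw [← ht]
      cases f
      · rfl
      · funext k; cases k <;> rfl
    obtain ⟨ρ, hρ⟩ : ∃ ρ, R.next d.state (fun k => d.tape k (d.head k)) = ρ := ⟨_, rfl⟩
    have h1 := OracleTM.To.step (φ := φ) (cfg (N := N) (R := R) (.rrun d.state f)
      ⟨hn, d.head, d.head .answer, hq, ha, i⟩ ⟨tn, tr, tx, tq, ta, counter (max m (i - 1))⟩)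
    rw [step_cfg (by simp) (by simp)] at h1
    simp only [next, if_neg hd, if_neg hs, read, key, hρ] at h1
    have hstep : R.step φ d = ⟨ρ.1, fun k => (ρ.2 k).2.apply (d.head k),
        fun k => Function.update (d.tape k) (d.head k) (ρ.2 k).1⟩ := by
      rw [OracleTM.step_of_move hd hs, OracleTM.move, hρ]
    rw [hstep]
    refine ⟨f, fun k => Function.update (tr k) (d.head k)
      ((bif f then withAnswer ρ.2 (tr .answer (d.head .answer), (ρ.2 .answer).2) else ρ.2) k).1,
      Function.update tx (d.head .answer)
        (bif f then ρ.2 .answer else (tx (d.head .answer), (ρ.2 .answer).2)).1,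
      ?_, ?_, ?_⟩
    · refine (congrArg _ ?_).mp (h1.mono one_le_two)
      congr 1
      · ext1
        · rfl
        · funext k
          cases f
          · rfl
          · cases k <;> rfl
        · cases f <;> rfl
        all_goals rfl
      · ext1 <;> simp [writeTapes, keepAll, keep]
        exact tick_counter m i
    · rw [← ht]
      cases f
      · rfl
      · funext k; cases k <;> rfl
    · intro j hj
      cases f
      · simp only [cond_false]
        rw [Function.update_of_ne (by omega)]
        exact hra j (by omega)
      · simp only [cond_true, withAnswer, Function.update_eq_self]
        exact hra j (by omega)

theorem simulate {b : Str} {n : ℕ} (hlt : ∀ i < n, (R.run φ b i).state ≠ R.halt)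
    (hn : TapeName N.Work → ℕ) (hq ha m : ℕ) (tn : TapeName N.Work → Tape) (tx tq ta : Tape) :
    ∃ f tr' tx', (comp N R).To φ (2 * n)
      (cfg (.rrun R.start false) ⟨hn, fun _ => 0, 0, hq, ha, 0⟩
        ⟨tn, (R.init b).tape, tx, tq, ta, counter m⟩)
      (cfg (.rrun (R.run φ b n).state f)
        ⟨hn, (R.run φ b n).head, (R.run φ b n).head .answer, hq, ha, n⟩
        ⟨tn, tr', tx', tq, ta, counter (max m (n - 1))⟩) ∧
      (bif f then withAnswer tr' tx' else tr') = (R.run φ b n).tape ∧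
      ∀ j > max m (n - 1), tr' .answer j = none := by
  induction n with
  | zero =>
    refine ⟨false, (R.init b).tape, tx, ?_, rfl, fun _ _ => rfl⟩
    rw [Nat.zero_sub, Nat.max_zero]
    exact OracleTM.To.refl _
  | succ n ih =>
    obtain ⟨f, tr, tx', h, ht, hra⟩ := ih fun i hi => hlt i (by omega)
    obtain ⟨f', tr', tx'', h', ht', hra'⟩ := simulate_step (N := N) (hn := hn) (hq := hq) (ha := ha)
      (tn := tn) (tq := tq) (ta := ta) (hlt n (by omega)) ht
      (OracleTM.head_run_le b n _) hra
    rw [OracleTM.run_succ]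
    exact ⟨f', tr', tx'', (h.trans h').mono (by omega), ht', hra'⟩

/-- The configuration `c` of the composition of two machines represents the configuration `d` of
the first machine. -/
def Represents (m : ℕ) (c : (comp N R).Cfg) (d : N.Cfg) : Prop :=
  ∃ tr tx, c = cfg (.nrun d.state)
      ⟨d.head, fun _ => 0, 0, d.head .query, d.head .answer, m + 1⟩
      ⟨d.tape, tr, tx, Tape.blank, Tape.blank, counter m⟩ ∧
    d.head .query ≤ m + 1 ∧ d.head .answer ≤ m + 1 ∧ (∀ j > m, d.tape .query j = none) ∧
    (∀ j > m, d.tape .answer j = none) ∧ ∀ k, ∀ j > m, tr k j = none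

theorem Represents.move {m : ℕ} {c : (comp N R).Cfg} {d : N.Cfg} (h : Represents m c d)
    (hd : d.state ≠ N.halt) (hd' : d.state ≠ N.query) (ψ : Baire) :
    Represents (m + 1) ((comp N R).step φ c) (N.step ψ d) := by
  obtain ⟨tr, tx, rfl, hq, ha, htq, hta, htr⟩ := h
  refine ⟨tr, tx, ?_, ?_, ?_, ?_, ?_, fun k j hj => htr k j (by omega)⟩
  · rw [step_cfg (by simpa using hd) (by simp), OracleTM.step_of_move hd hd']
    simp only [next, if_neg hd', read]
    congr 1
    have := update_counter m m
    rw [max_self, max_eq_right (by omega)] at this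
    ext1
    · rfl
    all_goals simp [writeTapes, keepAll, keep, this]
  · exact (OracleTM.head_step_le _ _).trans (by omega)
  · exact (OracleTM.head_step_le _ _).trans (by omega)
  · intro j hj
    rw [OracleTM.tape_step_eq _ (by simp) (by omega)]
    exact htq j (by omega)
  · intro j hj
    rw [OracleTM.step_of_move hd hd']
    simp only [OracleTM.move]
    rw [Function.update_of_ne (by omega)]
    exact hta j (by omega)

/-- The cost consists of three passes over the old extent m, two steps for each step of `R`, a
rewinding over n cells and three passes over the new extent, which is at most m + n. -/
theorem Represents.ask {m n : ℕ} {c : (comp N R).Cfg} {d : N.Cfg} (h : Represents m c d)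
    (hd : d.state ≠ N.halt) (hd' : d.state = N.query) {ψ : Baire}
    (hlt : ∀ i < n, (R.run φ (d.tape .query).content i).state ≠ R.halt)
    (hn : (R.run φ (d.tape .query).content n).state = R.halt)
    (hψ : ((R.run φ (d.tape .query).content n).tape .output).content =
      ψ (d.tape .query).content) :
    ∃ c', (comp N R).To φ (6 * (m + n) + 15) c c' ∧
      Represents (max m (n - 1)) c' (N.step ψ d) := by
  obtain ⟨tr, tx, rfl, hq, ha, htq, hta, htr⟩ := h
  set b := (d.tape .query).content with hb
  have hpre : Tape.ofStr b = (d.tape .query).pre :=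
    Tape.ofStr_content _ ⟨m + 1, htq _ (by omega)⟩
  have hblen : b.length ≤ m + 1 := Tape.content_length_le _ (htq _ (by omega))
  have h0 : (comp N R).step φ (cfg (.nrun d.state)
      ⟨d.head, fun _ => 0, 0, d.head .query, d.head .answer, m + 1⟩
      ⟨d.tape, tr, tx, Tape.blank, Tape.blank, counter m⟩) =
      cfg (.rew 0) ⟨d.head, fun _ => 0, 0, d.head .query, d.head .answer, m + 1⟩
      ⟨d.tape, tr, tx, markTape (d.head .query), markTape (d.head .answer), counter m⟩ := by
    rw [step_cfg (by simpa using hd) (by simp)]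
    simp only [next, if_pos hd', read]
    congr 1
    ext1 <;> simp [writeTapes, keepAll, keep, markTape]
  have h1 := rewind (φ := φ) (N := N) (R := R) 0
    ⟨d.head, fun _ => 0, 0, d.head .query, d.head .answer, m + 1⟩
    ⟨d.tape, tr, tx, markTape (d.head .query), markTape (d.head .answer), counter m⟩ rfl
    hq ha (fun _ => Nat.zero_le _) (Nat.zero_le _) hq ha
  have h2 := copyIn (φ := φ) (N := N) (R := R)
    ⟨d.head, fun _ => 0, 0, d.head .query, d.head .answer, m + 1⟩
    ⟨d.tape, tr, tx, markTape (d.head .query), markTape (d.head .answer), counter m⟩ rfl htq htr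
  have h3 := rewind (φ := φ) (N := N) (R := R) 1
    (mapHeads (fun _ => m + 1) ⟨d.head, fun _ => 0, 0, d.head .query, d.head .answer, m + 1⟩)
    ⟨d.tape, (R.init b).tape, tx, markTape (d.head .query), markTape (d.head .answer), counter m⟩
    rfl le_rfl le_rfl (fun _ => le_rfl) le_rfl le_rfl le_rfl
  have hinit : inputTapes (d.tape .query).pre = (R.init b).tape := by
    funext k
    cases k
    · exact hpre.symm
    all_goals rfl
  rw [hinit] at h2
  obtain ⟨f, tr', tx', h4, ht', hra⟩ := simulate (φ := φ) (N := N) (R := R) hlt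
    (mapQA (fun _ => 0) d.head) 0 0 m d.tape tx (markTape (d.head .query))
    (markTape (d.head .answer))
  set e := R.run φ b n with he
  set m' := max m (n - 1) with hm'
  -- Cells that `R` has not reached are as in its initial configuration, and its input fits into the
  -- cells up to m. Only `ra` needs the information from the simulation.
  have htr' : ∀ k, ∀ j > m', tr' k j = none := by
    intro k j hj
    by_cases hk : k = .answer
    · rw [hk]; exact hra j hj
    · have h : tr' k j = e.tape k j := by
        rw [← ht']
        cases f
        · rfl
        · cases k <;> first | rfl | exact absurd rfl hk
      rw [h, he, OracleTM.tape_run_eq b n hk (by omega)]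
      cases k
      · exact Tape.ofStr_eq_none.2 (by omega)
      all_goals rfl
  have hout : tr' .output = e.tape .output := by
    rw [← ht']
    cases f <;> rfl
  have h5 : (comp N R).step φ (cfg (.rrun e.state f)
        ⟨mapQA (fun _ => 0) d.head, e.head, e.head .answer, 0, 0, n⟩
        ⟨d.tape, tr', tx', markTape (d.head .query), markTape (d.head .answer), counter m'⟩) =
      cfg (.rew 2) ⟨mapQA (fun _ => 0) d.head, e.head, e.head .answer, 0, 0, n⟩
        ⟨d.tape, tr', tx', markTape (d.head .query), markTape (d.head .answer), counter m'⟩ := by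
    rw [step_cfg (by simp) (by simp)]
    simp only [next, if_pos hn]
    rw [writeTapes_keepAll, moveHeads_keepAll]
  have h6 := rewind (φ := φ) (N := N) (R := R) 2
    ⟨mapQA (fun _ => 0) d.head, e.head, e.head .answer, 0, 0, n⟩
    ⟨d.tape, tr', tx', markTape (d.head .query), markTape (d.head .answer), counter m'⟩ rfl
    (Nat.zero_le _) (Nat.zero_le _) (fun k => OracleTM.head_run_le b n k)
    (OracleTM.head_run_le b n _) (Nat.zero_le _) (Nat.zero_le _)
  have h7 := copyOut (φ := φ) (N := N) (R := R)
    ⟨mapQA (fun _ => 0) d.head, e.head, e.head .answer, 0, 0, n⟩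
    ⟨d.tape, tr', tx', markTape (d.head .query), markTape (d.head .answer), counter m'⟩ rfl
    (fun j hj => hta j (by omega)) (htr' _)
  have h8 := rewind (φ := φ) (N := N) (R := R) 3
    (mapHeads (fun _ => m' + 1) ⟨mapQA (fun _ => 0) d.head, e.head, e.head .answer, 0, 0, n⟩)
    ⟨withAnswer d.tape (tr' .output).pre, tr', tx', markTape (d.head .query),
      markTape (d.head .answer), counter m'⟩
    rfl le_rfl le_rfl (fun _ => le_rfl) le_rfl le_rfl le_rfl
  have h9 := restoreHeads (φ := φ) (N := N) (R := R) d.head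
    ⟨withAnswer d.tape (tr' .output).pre, tr', tx', markTape (d.head .query),
      markTape (d.head .answer), counter m'⟩ rfl (hq.trans (by omega)) (ha.trans (by omega)) rfl rfl
  have hheads : mapHeads (N := N) (R := R) (fun _ => 0) (mapHeads (fun _ => m' + 1)
      ⟨mapQA (fun _ => 0) d.head, e.head, e.head .answer, 0, 0, n⟩) =
      ⟨mapQA (fun _ => 0) d.head, fun _ => 0, 0, 0, 0, 0⟩ := by
    ext k
    · cases k <;> rfl
    all_goals rfl
  have hheads' : mapHeads (N := N) (R := R) (fun _ => 0) (mapHeads (fun _ => m + 1)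
      ⟨d.head, fun _ => 0, 0, d.head .query, d.head .answer, m + 1⟩) =
      ⟨mapQA (fun _ => 0) d.head, fun _ => 0, 0, 0, 0, 0⟩ := by
    ext k
    · cases k <;> rfl
    all_goals rfl
  rw [hheads'] at h3
  rw [hheads] at h8
  refine ⟨_, (((((((((h0 ▸ OracleTM.To.step _ : (comp N R).To φ 1 _ _).trans h1).trans h2).trans
    h3).trans h4).trans (h5 ▸ OracleTM.To.step _)).trans h6).trans h7).trans h8).trans h9
    |>.mono ?_, ?_⟩
  · simp only [mapHeads]
    omega
  · have hans : (tr' .output).pre = Tape.ofStr (ψ b) := by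
      rw [← hψ, hout, Tape.ofStr_content]
      exact ⟨n, OracleTM.tape_run_eq b n (by simp) le_rfl⟩
    have hstep : N.step ψ d = ⟨N.resume, d.head, withAnswer d.tape (Tape.ofStr (ψ b))⟩ := by
      rw [OracleTM.step_of_query hd hd']
      apply OracleTM.Cfg.ext
      · rfl
      · rfl
      · funext k; cases k <;> rfl
    rw [hstep, ← hans]
    refine ⟨tr', tx', rfl, hq.trans (by omega), ha.trans (by omega), fun j hj => htq j (by omega),
      fun j hj => pre_eq_none (htr' _ j hj), htr'⟩

theorem represents_init (a : Str) :
    Represents 0 ((comp N R).step φ ((comp N R).init a)) (N.init a) := by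
  have h : (comp N R).init a = cfg .boot ⟨fun _ => 0, fun _ => 0, 0, 0, 0, 0⟩
      ⟨(N.init a).tape, fun _ => Tape.blank, Tape.blank, Tape.blank, Tape.blank, Tape.blank⟩ := by
    apply OracleTM.Cfg.ext
    · rfl
    · funext k
      rcases k with _ | _ | _ | _ | (_ | _ | _ | _ | _ | _ | _ | _ | _ | _) <;> rfl
    · funext k
      rcases k with _ | _ | _ | _ | (_ | _ | _ | _ | _ | _ | _ | _ | _ | _) <;> rfl
  refine ⟨fun _ => Tape.blank, Tape.blank, ?_, Nat.zero_le _, Nat.zero_le _, fun _ _ => rfl,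
    fun _ _ => rfl, fun _ _ _ => rfl⟩
  rw [h, step_cfg (by simp) (by simp)]
  simp only [next]
  congr 1
  ext1 <;> simp [writeTapes, keepAll, keep, read, update_blank_eq_counter]

/-- The extent does not accumulate over calls: an ordinary step adds one cell, while a call only
raises the extent to at most `B` if it was smaller. So each step of `N` has the same cost bound. -/
theorem represents_run {ψ : Baire} {a : Str} {n B : ℕ}
    (hR : ∀ b : Str, b.length ≤ n → ∃ t ≤ B, (R.run φ b t).state = R.halt ∧
      ((R.run φ b t).tape .output).content = ψ b) {i : ℕ} (hi : i ≤ n) :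
    ∃ m ≤ i + B, ∃ c, (comp N R).To φ (i * (6 * (n + 2 * B) + 15) + 1) ((comp N R).init a) c ∧
      Represents m c (N.run ψ a i) := by
  induction i with
  | zero =>
    exact ⟨0, Nat.zero_le _, _, by simpa using OracleTM.To.step _, represents_init a⟩
  | succ i ih =>
    obtain ⟨m, hm, c, hc, hrep⟩ := ih (by omega)
    rw [OracleTM.run_succ]
    by_cases hd : (N.run ψ a i).state = N.halt
    · rw [OracleTM.step_of_halt hd]
      exact ⟨m, by omega, c, hc.mono (by gcongr; omega), hrep⟩
    by_cases hd' : (N.run ψ a i).state = N.query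
    · set b := ((N.run ψ a i).tape .query).content with hb
      have hlen : b.length ≤ n :=
        (Tape.content_length_le _ (OracleTM.tape_run_eq a i (by simp) le_rfl)).trans (by omega)
      obtain ⟨t, ht, hhalt, hout⟩ := hR b hlen
      classical
      -- The simulation stops at the first halting time of `R`, which may precede the given one.
      have hex : ∃ t, (R.run φ b t).state = R.halt := ⟨t, hhalt⟩
      have hle : Nat.find hex ≤ t := Nat.find_min' hex hhalt
      rw [OracleTM.run_eq_of_halt hle (Nat.find_spec hex)] at hout
      obtain ⟨c', hc', hrep'⟩ := hrep.ask (φ := φ) (ψ := ψ) hd hd'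
        (fun j hj => Nat.find_min hex hj) (Nat.find_spec hex) hout
      refine ⟨_, ?_, c', (hc.trans hc').mono ?_, hrep'⟩
      · omega
      · have : m + Nat.find hex ≤ n + 2 * B := by omega
        rw [Nat.succ_mul i]
        omega
    · refine ⟨m + 1, by omega, _, (hc.trans (OracleTM.To.step _)).mono ?_, hrep.move hd hd' ψ⟩
      rw [Nat.succ_mul i]
      omega

end CompMachine

-- Within n steps `N` can only write queries of length at most n, so `R` has to be controlled on
-- those strings only.
open CompMachine in
theorem comp_returns {N R : OracleTM} {φ ψ : Baire} {a b : Str} {n B : ℕ}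
    (hR : ∀ b : Str, b.length ≤ n → ∃ t ≤ B, (R.run φ b t).state = R.halt ∧
      ((R.run φ b t).tape .output).content = ψ b)
    (hN : N.Returns ψ a b) (hN' : N.HaltsWithin ψ a n) :
    (comp N R).Returns φ a b ∧
      (comp N R).HaltsWithin φ a (n * (6 * (n + 2 * B) + 15) + 1) := by
  obtain ⟨-, i, hi, hhalt, hout⟩ := hN.length_le hN'
  obtain ⟨m, -, c, hc, tr, tx, rfl, -⟩ := represents_run (N := N) (a := a) hR hi
  refine (hc.mono ?_).returns ?_ hout
  · gcongr
  · exact congrArg CompState.nrun hhalt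

/-- Composition of a functional in `P(A)` with a polynomial-time computable map into `A`. -/
theorem polyTimeComputable_comp {A : Set Baire} {F : A → Baire} (hF : F ∈ restrictedPolyTime A)
    {R : Baire → A} (hR : PolyTimeComputable fun φ => (R φ : Baire)) :
    PolyTimeComputable fun φ => F (R φ) := by
  obtain ⟨N, hN, Q, hQ, hNQ⟩ := hF
  obtain ⟨M, hM, P, hP, hMP⟩ := hR
  have key : ∀ (φ : Baire) (a : Str), (comp N M).Returns φ a (F (R φ) a) ∧
      (comp N M).HaltsWithin φ a (Q (P (size φ)) a.length *
        (6 * (Q (P (size φ)) a.length + 2 * P (size φ) (Q (P (size φ)) a.length)) + 15) + 1) := by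
    intro φ a
    have hPm : Monotone (P (size φ)) := fun _ _ h => hP.mono le_rfl (size_mono φ) h
    -- The running time of the machine for `R` bounds the lengths of its values.
    have hsize : size (R φ) ≤ P (size φ) := by
      intro n
      obtain ⟨b, hb, h⟩ := exists_length_eq_size (R φ : Baire) n
      rw [← h]
      exact ((hM φ b).length_le (hMP φ b)).1.trans (hPm hb)
    have hn : N.HaltsWithin (R φ) a (Q (P (size φ)) a.length) := by
      obtain ⟨m, hm, h⟩ := hNQ _ (R φ).2 a
      exact ⟨m, hm.trans (hQ.mono hsize hPm le_rfl), h⟩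
    refine comp_returns (fun b hb => ?_) (hN (R φ) a) hn
    obtain ⟨-, m, hm, h, h'⟩ := (hM φ b).length_le (hMP φ b)
    exact ⟨m, hm.trans (hPm hb), h, h'⟩
  have hS := hQ.comp_fun hP
  refine ⟨comp N M, fun φ a => (key φ a).1, fun l n => Q (P l) n *
    (6 * (Q (P l) n + 2 * P l (Q (P l) n)) + 15) + 1, ?_, fun φ a => (key φ a).2⟩
  exact (hS.mul (((IsSecondOrderPoly.const 6).mul (hS.add ((IsSecondOrderPoly.const 2).mul
    (hP.comp_arg hS)))).add (.const 15))).add (.const 1)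

/-! ### Comparison of the two classes and the main theorem -/

theorem extendablePolyTime_subset (A : Set Baire) :
    extendablePolyTime A ⊆ restrictedPolyTime A := by
  rintro F ⟨G, ⟨M, hM, P, hP, hMP⟩, hG⟩
  exact ⟨M, fun φ a => hG φ ▸ hM φ a, P, hP, fun φ _ a => hMP φ a⟩

theorem extendablePolyTime_eq {A : Set Baire} {R : Baire → A} (hR : IsRetraction R)
    (hR' : PolyTimeComputable fun φ => (R φ : Baire)) :
    extendablePolyTime A = restrictedPolyTime A :=
  (extendablePolyTime_subset A).antisymm fun F hF =>
    ⟨fun φ => F (R φ), polyTimeComputable_comp hF hR', fun φ => congrArg F (hR φ)⟩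

end SecondOrder

theorem mainTheorem6 :
    (∀ A : Set SecondOrder.Baire,
      (∃ R : SecondOrder.Baire → A, SecondOrder.IsRetraction R ∧
        SecondOrder.PolyTimeComputable (fun φ => (R φ : SecondOrder.Baire))) →
      SecondOrder.extendablePolyTime A = SecondOrder.restrictedPolyTime A) ∧
    (∃ R : SecondOrder.Baire → SecondOrder.reg, SecondOrder.IsRetraction R ∧
      SecondOrder.PolyTimeComputable (fun φ => (R φ : SecondOrder.Baire))) ∧
    (∀ F : SecondOrder.reg → SecondOrder.Baire,
      SecondOrder.KawamuraCookPolyTime F ↔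
        ∃ G : SecondOrder.Baire → SecondOrder.Baire,
          SecondOrder.PolyTimeComputable G ∧ ∀ φ : SecondOrder.reg, G φ = F φ) := by
  have hreg : SecondOrder.IsRetraction (A := SecondOrder.reg)
      fun φ => ⟨SecondOrder.regularize φ, SecondOrder.regularize_mem_reg φ⟩ :=
    fun φ => Subtype.ext (SecondOrder.regularize_of_mem_reg φ.2)
  have hpoly := SecondOrder.polyTimeComputable_regularize
  refine ⟨fun A ⟨R, hR, hR'⟩ => SecondOrder.extendablePolyTime_eq hR hR',
    ⟨_, hreg, hpoly⟩, fun F => ?_⟩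
  exact Set.ext_iff.1 (SecondOrder.extendablePolyTime_eq hreg hpoly).symm F
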